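/- **Conventions.** Let $k$ be an integer and let $\chi$ be a primitive Dirichlet character modulo a positive integer $N$ with values in $\{0,\pm1\}$ (so $\chi$ is quadratic of conductor $N$, or $N=1$ and $\chi$ is trivial). For a prime $p\mid N$ let $N_p$ be the exact power of $p$ dividing $N$ (thus $N_p=p$ for odd $p$, and $N_2\in\{4,8\}$ if $2\mid N$; put $N_2=1$ if $N$ is odd), and write $\chi=\prod_{p\mid N}\chi_p$ with $\chi_p$ a character modulo $N_p$. Let $A(N,k,\chi)$ be the space of weakly holomorphic modular forms of level $N$, weight $k$ and character $\chi$: holomorphic functions $f$ on the upper half plane, meromorphic at all cusps, with $f|_kM=\chi(d)f$ for all $M=\begin{pmatrix}a&b\\c&d\end{pmatrix}\in\Gamma_0(N)$, where $(f|_kM)(\tau)=(c\tau+d)^{-k}f(M\tau)$. For a sign vector $\epsilon=(\epsilon_p)_{p\mid N}\in\{\pm1\}^{\omega(N)}$, where $\omega(N)$ is the number of primes dividing $N$, let $$A^\epsilon(N,k,\chi)=\Big\{f=\sum_{n\in\mathbb Z} a(n)q^n\in A(N,k,\chi)\ :\ a(n)=0\text{ if }\chi_p(n)=-\epsilon_p\text{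 for some prime }p\mid N\Big\},\qquad q=e^{2\pi i\tau}.$$ For a cusp $s=\gamma\infty$ with $\gamma\in\mathrm{SL}_2(\mathbb Z)$, the Fourier expansion of $f$ at $s$ is that of $f|_k\gamma$, expressed in the local parameter $q_s=e^{2\pi i\tau/w}$ (or in its root $q_s^{1/2}=e^{2\pi i\tau/(2w)}$), where $w$ is the width of $s$, i.e. the least positive integer with $\gamma\begin{pmatrix}1&w\\0&1\end{pmatrix}\gamma^{-1}\in\Gamma_0(N)$. Which powers occur does not depend on the choice of $\gamma$. We write $s\sim t$ if the cusps $s,t$ are equivalent under $\Gamma_0(N)$. **Proposition.** Let $f=\sum_n a(n)q^n\in A^\epsilon(N,k,\chi)$, let $s$ be a cusp, and let $m_1$ be a positive odd divisor of $N$. 1. If $s\sim\frac1m$ with $m=m_1$ or $m=N_2m_1$, then the Fourier expansion of $f$ at $s$ is a series in integral powers of $q_s$, and $q_s^n$ occurs in it (with nonzero coefficient) if and only if $a(nN/m)\neq0$. 2. If $4\mid N$ and $s\sim\frac1{2m_1}$, then the Fourier expansion of $f$ at $s$ is a series in integral powers of $q_s^{1/2}$, and $q_s^{n/2}$ can occur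 in it only if $a\!\left(\frac{nN}{2m_1}\right)\neq0$. 3. If $8\mid N$ and $s\sim\frac1{4m_1}$, then the Fourier expansion of $f$ at $s$ is a series in integral powers of $q_s^{1/2}$, and $q_s^{n/2}$ can occur in it only if $a\!\left(\frac{nN}{4m_1}\right)\neq0$. -/

import Mathlib

open UpperHalfPlane Matrix.SpecialLinearGroup
open scoped ModularForm MatrixGroups Manifold OnePoint

/-- `g` has, on the whole upper half plane, the Fourier expansion
`g(τ) = ∑ₙ c(n) e^(2πi n τ / h)` with only finitely many nonzero terms of negative index. -/
def HasFourierExpansion (h : ℕ) (g : ℍ → ℂ) (c : ℤ → ℂ) : Prop :=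
  (∃ n₀ : ℤ, ∀ n < n₀, c n = 0) ∧
    ∀ τ : ℍ, HasSum (fun n : ℤ ↦ c n * Function.Periodic.qParam (h : ℝ) (τ : ℂ) ^ n) (g τ)

/-- The space `A(N, k, χ)` of weakly holomorphic modular forms of level `N`, weight `k` and
character `χ`: holomorphic on the upper half plane, transforming under `Γ₀(N)` with character `χ`
(evaluated at the lower right entry), and meromorphic at every cusp. -/
structure IsWeaklyHolomorphicForm (N : ℕ) (k : ℤ) (χ : DirichletCharacter ℂ N) (f : ℍ → ℂ) :
    Prop where
  holo : MDifferentiable 𝓘(ℂ) 𝓘(ℂ) f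
  slash : ∀ M ∈ CongruenceSubgroup.Gamma0 N, f ∣[k] M = χ ((M 1 1 : ℤ) : ZMod N) • f
  meromorphic_cusps : ∀ γ : SL(2, ℤ), ∃ h : ℕ, 0 < h ∧
    ∃ c : ℤ → ℂ, HasFourierExpansion h (f ∣[k] γ) c

/-- For a prime `p ∣ N`, the ring isomorphism `ℤ/N ≃ ℤ/p^v × ℤ/(N/p^v)`, where `p^v ∥ N`. -/
noncomputable def primeSplitting (N : ℕ) (p : N.primeFactors) :
    ZMod N ≃+* ZMod ((p : ℕ) ^ N.factorization p) × ZMod (N / (p : ℕ) ^ N.factorization p) :=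
  (ZMod.ringEquivCongr (Nat.ordProj_mul_ordCompl_eq_self N p).symm).trans
    (ZMod.chineseRemainder ((Nat.coprime_ordCompl (Nat.prime_of_mem_primeFactors p.2)
      (Nat.mem_primeFactors.mp p.2).2.2).pow_left _))

/-- The `p`-component `χ_p` of a Dirichlet character `χ` modulo `N`: the character modulo the
`p`-part of `N` with `χ_p(n) = χ(x)`, where `x ≡ n` modulo the `p`-part of `N` and `x ≡ 1` modulo
the prime-to-`p` part of `N`. Thus `χ = ∏_{p ∣ N} χ_p`. -/
noncomputable def primeComponent {N : ℕ} (χ : DirichletCharacter ℂ N) (p : N.primeFactors) :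
    DirichletCharacter ℂ ((p : ℕ) ^ N.factorization p) where
  toFun n := χ ((primeSplitting N p).symm (n, 1))
  map_one' := by
    rw [show ((1, 1) : ZMod ((p : ℕ) ^ N.factorization p) ×
      ZMod (N / (p : ℕ) ^ N.factorization p)) = 1 from rfl, map_one, map_one]
  map_mul' a b := by
    rw [← map_mul, ← map_mul, Prod.mk_mul_mk, one_mul]
  map_nonunit' a ha := by
    refine χ.map_nonunit fun hu ↦ ha ?_
    have := hu.map (primeSplitting N p)
    rw [RingEquiv.apply_symm_apply] at this
    exact (Prod.isUnit_iff.mp this).1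

/-- The subspace `A^ε(N, k, χ)` of `A(N, k, χ)` attached to a sign vector `ε = (ε_p)_{p ∣ N}`: the
forms `f = ∑ a(n) qⁿ` with `a(n) = 0` whenever `χ_p(n) = -ε_p` for some prime `p ∣ N`. -/
def weaklyHolomorphicEps (N : ℕ) (k : ℤ) (χ : DirichletCharacter ℂ N) (ε : N.primeFactors → ℤˣ) :
    Set (ℍ → ℂ) :=
  {f | IsWeaklyHolomorphicForm N k χ f ∧ ∃ a : ℤ → ℂ, HasFourierExpansion 1 f a ∧
    ∀ n : ℤ, (∃ p : N.primeFactors, primeComponent χ p n = -((ε p : ℤ) : ℂ)) → a n = 0}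

/-- The cusp `γ∞ ∈ ℙ¹(ℚ)`. -/
noncomputable def cuspOf (γ : SL(2, ℤ)) : OnePoint ℚ :=
  mapGL ℚ γ • (∞ : OnePoint ℚ)

/-- Equivalence of cusps under `Γ₀(N)`. -/
def CuspEquiv (N : ℕ) (s t : OnePoint ℚ) : Prop :=
  ∃ M ∈ CongruenceSubgroup.Gamma0 N, mapGL ℚ M • s = t

/-- The width of the cusp `γ∞` of `Γ₀(N)`: the least `h > 0` with `γ T^h γ⁻¹ ∈ Γ₀(N)`
(recall `-1 ∈ Γ₀(N)`). The local parameter at `γ∞` is `q_s = e^(2πi τ / h)`. -/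
noncomputable def cuspWidth (N : ℕ) (γ : SL(2, ℤ)) : ℕ :=
  sInf {h : ℕ | 0 < h ∧ γ * ModularGroup.T ^ h * γ⁻¹ ∈ CongruenceSubgroup.Gamma0 N}

/-! Up to a constant, put g(τ) = f(τ/N). Then g transforms by χ under Γ⁰(N), so g|γ depends, up to a
value of χ, only on the first row of γ modulo N. For N = mQ one has (1 0; m 1) = diag(1/N, 1) (Q -1;
1 0) (m 1; 0 Q), and the last factor only rescales and shifts the variable. So the expansion at 1/m
is that of G = g|(Q -1; 1 0), and the point is that G arises from g by multiplying the n-th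
coefficient by a number κ(n).

By the Chinese remainder theorem the row (Q, -1) can be installed one prime at a time. Let e be the
idempotent of p and p^v the p-part of N. The inversion at p lies in the span of the translates
g|T^(ej) (`slash_partialInversion_mem`). Translates act diagonally on coefficients and commute with
inversions at other primes, so κ is a product of local multipliers
(`HasFourierExpansion.slash_partialInversion_sum`).

Membership in the span comes from the sign condition. It kills a residue class n₀ mod p^v, which is
a relation ∑ r^j g|T^(ej) = 0. Inverting at p gives the same relation among forms W_j with row (j,
-1) at p. For a unit j this row is j(1, -1/j), so W_j is a multiple of a translate. The relation
then yields the remaining W_j: only W_0 for odd p, while for 4 and 8 the even W_j are separated by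
their behaviour under T^e, using χ₂(3) = -1 or χ₂(5) = -1.

So G only involves n with a(n) ≠ 0, and only multiples of Q since T^m fixes (Q, -1) mod N.
Conversely, if p ∤ Q the inversion is a single translate, and if p^v ∣ Q a zero multiplier would
force g = 0 (`exists_slash_partialInversion_eq`); so κ(n) ≠ 0 on multiples of Q. The intermediate
case occurs at 1/(2m₁) and 1/(4m₁), where only one implication is claimed and the width is Q/2,
whence the half-integral powers. -/

open Function.Periodic in
/-- The translates of `q^n` under `τ ↦ τ + z`. -/
theorem qParam_add (h : ℝ) (z w : ℂ) : qParam h (z + w) = qParam h z * qParam h w := by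
  rw [qParam, qParam, qParam, ← Complex.exp_add]
  congr 1
  ring

/-! ### Fourier expansions: linearity, translation, uniqueness. -/

namespace HasFourierExpansion

open Function.Periodic

variable {h : ℕ} {g : ℍ → ℂ} {c : ℤ → ℂ}

theorem zero (h : ℕ) : HasFourierExpansion h 0 0 :=
  ⟨⟨0, fun _ _ ↦ rfl⟩, fun τ ↦ by simp⟩

theorem add {g' : ℍ → ℂ} {c' : ℤ → ℂ} (hg : HasFourierExpansion h g c)
    (hg' : HasFourierExpansion h g' c') : HasFourierExpansion h (g + g') (c + c') := by
  obtain ⟨⟨n, hn⟩, hs⟩ := hg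
  obtain ⟨⟨n', hn'⟩, hs'⟩ := hg'
  refine ⟨⟨min n n', fun i hi ↦ ?_⟩, fun τ ↦ ?_⟩
  · rw [Pi.add_apply, hn i (hi.trans_le (min_le_left _ _)),
      hn' i (hi.trans_le (min_le_right _ _)), add_zero]
  · simpa [add_mul] using (hs τ).add (hs' τ)

theorem const_smul (r : ℂ) (hg : HasFourierExpansion h g c) :
    HasFourierExpansion h (r • g) (fun n ↦ r * c n) := by
  obtain ⟨⟨n, hn⟩, hs⟩ := hg
  refine ⟨⟨n, fun i hi ↦ by simp [hn i hi]⟩, fun τ ↦ ?_⟩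
  simpa [mul_assoc] using (hs τ).mul_left r

theorem sum {ι : Type*} (s : Finset ι) {G : ι → ℍ → ℂ} {C : ι → ℤ → ℂ}
    (hG : ∀ i ∈ s, HasFourierExpansion h (G i) (C i)) :
    HasFourierExpansion h (∑ i ∈ s, G i) (∑ i ∈ s, C i) := by
  classical
  induction s using Finset.induction_on with
  | empty => simpa using zero h
  | insert i t hi ih =>
    rw [Finset.sum_insert hi, Finset.sum_insert hi]
    exact (hG i (Finset.mem_insert_self _ _)).add
      (ih fun j hj ↦ hG j (Finset.mem_insert_of_mem hj))

theorem congr_coeff {c' : ℤ → ℂ} (hg : HasFourierExpansion h g c) (hc : ∀ n, c n = c' n) :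
    HasFourierExpansion h g c' := by
  obtain rfl : c = c' := funext hc
  exact hg

theorem slash_T_zpow (k x : ℤ) (hg : HasFourierExpansion h g c) :
    HasFourierExpansion h (g ∣[k] (ModularGroup.T ^ x))
      (fun n ↦ c n * qParam (h : ℝ) (x : ℂ) ^ n) := by
  obtain ⟨⟨n, hn⟩, hs⟩ := hg
  refine ⟨⟨n, fun i hi ↦ by simp [hn i hi]⟩, fun τ ↦ ?_⟩
  have hval : (g ∣[k] (ModularGroup.T ^ x)) τ = g (ModularGroup.T ^ x • τ) := by
    rw [ModularForm.SL_slash_apply, denom]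
    simp [ModularGroup.coe_T_zpow, -map_zpow]
  rw [hval]
  convert hs (ModularGroup.T ^ x • τ) using 2 with i
  rw [ModularGroup.coe_T_zpow_smul_eq, qParam_add, mul_zpow]
  ring

/-- Fourier expansions are unique. -/
theorem unique {c' : ℤ → ℂ} (hh : 0 < h) (hg : HasFourierExpansion h g c)
    (hg' : HasFourierExpansion h g c') : c = c' := by
  obtain ⟨⟨n₀, hn₀⟩, hs⟩ := hg.add (hg'.const_smul (-1))
  have hzero : g + (-1 : ℂ) • g = 0 := by simp
  rw [hzero] at hs
  set d : ℤ → ℂ := c + fun n ↦ -1 * c' n with hd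
  have hh' : (0 : ℝ) < h := by exact_mod_cast hh
  -- Dividing by q^n₀ leaves a power series in q that sums to the zero function, so its Taylor
  -- coefficients at q = 0 vanish.
  have hnat : ∀ τ : ℍ, HasSum (fun m : ℕ ↦ d (n₀ + m) • qParam (h : ℝ) τ ^ m)
      ((0 : ℍ → ℂ) τ) := by
    intro τ
    have hinj : Function.Injective (fun m : ℕ ↦ n₀ + (m : ℤ)) := fun a b hab ↦ by
      simpa using hab
    have h1 := (hinj.hasSum_iff (f := fun n : ℤ ↦ d n * qParam (h : ℝ) τ ^ n)
      (a := (0 : ℍ → ℂ) τ) ?_).mpr (hs τ)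
    · have h2 := h1.mul_left (qParam (h : ℝ) τ ^ (-n₀))
      rw [Pi.zero_apply, mul_zero] at h2
      have hq : qParam (h : ℝ) τ ≠ 0 := qParam_ne_zero _
      have h3 : ∀ m : ℕ, d (n₀ + m) • qParam (h : ℝ) τ ^ m = qParam (h : ℝ) τ ^ (-n₀) *
          ((fun n : ℤ ↦ d n * qParam (h : ℝ) τ ^ n) ∘ fun m : ℕ ↦ n₀ + (m : ℤ)) m := by
        intro m
        simp only [Function.comp_apply, smul_eq_mul, zpow_add₀ hq, zpow_neg, zpow_natCast]
        field_simp
      simp_rw [h3]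
      exact h2
    · intro x hx
      have : x < n₀ := by
        by_contra hlt
        exact hx ⟨(x - n₀).toNat, by simp; omega⟩
      simp [hn₀ x this]
  have hcusp : UpperHalfPlane.cuspFunction (h : ℝ) (0 : ℍ → ℂ) = fun _ ↦ 0 := by
    funext q
    rcases eq_or_ne q 0 with rfl | hq
    · exact IsZeroAtImInfty.cuspFunction_apply_zero (f := (0 : ℍ → ℂ))
        (Filter.zero_zeroAtFilter _) hh'
    · exact Function.Periodic.cuspFunction_eq_of_nonzero _ _ hq
  have hd0 : ∀ m : ℕ, d (n₀ + m) = 0 := by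
    have h1 := (hasFPowerSeriesOnBall_cuspFunction hh'
      (by rw [hcusp]; exact analyticAt_const) hnat).hasFPowerSeriesAt
    rw [hcusp] at h1
    have h2 := h1.eq_zero
    intro m
    have h3 := congrArg (fun p ↦ FormalMultilinearSeries.coeff p m) h2
    rw [FormalMultilinearSeries.coeff_ofScalars] at h3
    exact h3.trans rfl
  funext n
  have hdn : d n = 0 := by
    rcases lt_or_ge n n₀ with hlt | hge
    · exact hn₀ n hlt
    · have := hd0 (n - n₀).toNat
      rwa [show n₀ + ((n - n₀).toNat : ℤ) = n by omega] at this
  simp only [hd, Pi.add_apply] at hdn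
  linear_combination hdn

end HasFourierExpansion

/-- The action of an upper triangular matrix of positive determinant. -/
theorem exists_slash_triangular (k : ℤ) (a b d : ℝ) (ha : 0 < a) (hd : 0 < d)
    (U : GL (Fin 2) ℝ) (hU : (U : Matrix (Fin 2) (Fin 2) ℝ) = !![a, b; 0, d]) :
    ∃ C : ℂ, C ≠ 0 ∧ ∀ τ : ℍ, ∃ τ' : ℍ, (τ' : ℂ) = (a * τ + b) / d ∧
      ∀ g : ℍ → ℂ, (g ∣[k] U) τ = C * g τ' := by
  have hdet : U.det.val = a * d := by
    rw [Matrix.GeneralLinearGroup.val_det_apply, hU, Matrix.det_fin_two_of]; ring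
  have hpos : 0 < U.det.val := by rw [hdet]; positivity
  refine ⟨(a * d : ℝ) ^ (k - 1) * (d : ℂ) ^ (-k), ?_, fun τ ↦ ⟨U • τ, ?_, fun g ↦ ?_⟩⟩
  · have : (d : ℂ) ≠ 0 := by exact_mod_cast hd.ne'
    have h2 : ((a * d : ℝ) : ℂ) ≠ 0 := by exact_mod_cast (mul_pos ha hd).ne'
    exact mul_ne_zero (zpow_ne_zero _ h2) (zpow_ne_zero _ this)
  · rw [coe_smul_of_det_pos hpos]
    simp [num, denom, hU]
  · rw [ModularForm.slash_apply, hdet, abs_of_pos (mul_pos ha hd)]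
    rw [σ, if_pos hpos]
    simp [denom, hU]
    ring

/-! ### Partial inversions and invariance by first rows. -/

open ModularGroup (T)

theorem T_zpow_apply_zero_zero (x : ℤ) : (T ^ x) 0 0 = 1 := by
  rw [ModularGroup.coe_T_zpow]; rfl

theorem T_zpow_apply_zero_one (x : ℤ) : (T ^ x) 0 1 = x := by
  rw [ModularGroup.coe_T_zpow]; rfl

theorem T_zpow_apply_one_zero (x : ℤ) : (T ^ x) 1 0 = 0 := by
  rw [ModularGroup.coe_T_zpow]; rfl

theorem T_zpow_apply_one_one (x : ℤ) : (T ^ x) 1 1 = 1 := by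
  rw [ModularGroup.coe_T_zpow]; rfl

theorem specialLinearGroup_mul_apply (A B : SL(2, ℤ)) (i j : Fin 2) :
    (A * B) i j = A i 0 * B 0 j + A i 1 * B 1 j := by
  rw [coe_mul, Matrix.mul_apply, Fin.sum_univ_two]

/-- Modulo `N`, if `E` is idempotent, this matrix is `T^Q S` on the `E`-part and trivial on the
complementary part. -/
def partialInversion (E Q : ℤ) : SL(2, ℤ) :=
  ⟨!![1 + (Q - 1) * E ^ 2, (Q - 1) * E - E - (Q - 1) * E ^ 3; E, 1 - E ^ 2], by
    rw [Matrix.det_fin_two_of]; ring⟩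

section partialInversion

variable {R : Type*} [CommRing R] {E : ℤ}

/-- The higher powers of E in the definition make the determinant 1 over ℤ for every E; they
collapse once E is idempotent. -/
theorem partialInversion_apply_zero_zero (hE : (E : R) * E = E) (Q : ℤ) :
    ((partialInversion E Q 0 0 : ℤ) : R) = 1 + (Q - 1) * E := by
  have : partialInversion E Q 0 0 = 1 + (Q - 1) * E ^ 2 := rfl
  rw [this]; push_cast; linear_combination (Q - 1 : R) * hE

theorem partialInversion_apply_zero_one (hE : (E : R) * E = E) (Q : ℤ) :
    ((partialInversion E Q 0 1 : ℤ) : R) = -E := by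
  have : partialInversion E Q 0 1 = (Q - 1) * E - E - (Q - 1) * E ^ 3 := rfl
  rw [this]; push_cast; linear_combination (-(Q - 1 : R)) * (1 + E) * hE

theorem partialInversion_apply_one_zero (Q : ℤ) :
    ((partialInversion E Q 1 0 : ℤ) : R) = E := rfl

theorem partialInversion_apply_one_one (hE : (E : R) * E = E) (Q : ℤ) :
    ((partialInversion E Q 1 1 : ℤ) : R) = 1 - E := by
  have : partialInversion E Q 1 1 = 1 - E ^ 2 := rfl
  rw [this]; push_cast; linear_combination -hE

end partialInversion

/-- `g ∣[k] γ` depends, up to the character `χ`, only on the first row of `γ` modulo `N`, regarded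
as a point of the projective line over `ℤ/N`. -/
def IsRowInvariant (N : ℕ) (k : ℤ) (χ : DirichletCharacter ℂ N) (g : ℍ → ℂ) : Prop :=
  ∀ (γ γ' : SL(2, ℤ)) (u : ZMod N), IsUnit u → ((γ' 0 0 : ℤ) : ZMod N) = u * (γ 0 0 : ℤ) →
    ((γ' 0 1 : ℤ) : ZMod N) = u * (γ 0 1 : ℤ) → g ∣[k] γ' = χ u • g ∣[k] γ

/-- The span of the translates of `g` by multiples of `E`. -/
def translateSpan (k : ℤ) (g : ℍ → ℂ) (E : ℤ) : Submodule ℂ (ℍ → ℂ) :=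
  Submodule.span ℂ (Set.range fun j : ℤ ↦ g ∣[k] (T ^ (E * j)))

theorem slash_T_zpow_mem_translateSpan {k : ℤ} {g : ℍ → ℂ} {E : ℤ} {x : ℍ → ℂ}
    (hx : x ∈ translateSpan k g E) (i : ℤ) : x ∣[k] (T ^ (E * i)) ∈ translateSpan k g E := by
  induction hx using Submodule.span_induction with
  | mem y hy =>
    obtain ⟨j, rfl⟩ := hy
    refine Submodule.subset_span ⟨j + i, ?_⟩
    simp only [← SlashAction.slash_mul, ← zpow_add, mul_add]
  | zero => rw [SlashAction.zero_slash]; exact Submodule.zero_mem _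
  | add y z _ _ hy hz => rw [SlashAction.add_slash]; exact Submodule.add_mem _ hy hz
  | smul c y _ hy => rw [ModularForm.SL_smul_slash]; exact Submodule.smul_mem _ _ hy

namespace IsRowInvariant

variable {N : ℕ} {k : ℤ} {χ : DirichletCharacter ℂ N} {g : ℍ → ℂ} {E : ℤ}

theorem slash_eq (hg : IsRowInvariant N k χ g) {γ γ' : SL(2, ℤ)}
    (h0 : ((γ' 0 0 : ℤ) : ZMod N) = (γ 0 0 : ℤ)) (h1 : ((γ' 0 1 : ℤ) : ZMod N) = (γ 0 1 : ℤ)) :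
    g ∣[k] γ' = g ∣[k] γ := by
  simpa using hg γ γ' 1 isUnit_one (by simpa using h0) (by simpa using h1)

end IsRowInvariant

/-- The translate of `g` by `E j`, inverted at the `E`-part. -/
noncomputable def invertedTranslate (k : ℤ) (g : ℍ → ℂ) (E j : ℤ) : ℍ → ℂ :=
  g ∣[k] (T ^ (E * j) * partialInversion E 0)

/-! ### Inversion at one prime lies in the span of translates. -/

section translates

variable {N : ℕ} {k : ℤ} {χ : DirichletCharacter ℂ N} {g : ℍ → ℂ} {E : ℤ}

/-- The first row is (j, ij - 1) on the E-part and (1, 0) off it. All coincidences among the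
inverted translates W_j below are read off from it. -/
theorem translate_inversion_translate_apply_zero_zero (hE : (E : ZMod N) * E = E) (j i : ℤ) :
    (((T ^ (E * j) * partialInversion E 0 * T ^ (E * i)) 0 0 : ℤ) : ZMod N) = 1 - E + E * j := by
  simp only [specialLinearGroup_mul_apply, T_zpow_apply_zero_zero, T_zpow_apply_zero_one,
    T_zpow_apply_one_zero]
  push_cast
  rw [partialInversion_apply_zero_zero hE, partialInversion_apply_one_zero,
    partialInversion_apply_zero_one hE, partialInversion_apply_one_one hE]
  push_cast
  linear_combination (j : ZMod N) * hE

theorem translate_inversion_translate_apply_zero_one (hE : (E : ZMod N) * E = E) (j i : ℤ) :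
    (((T ^ (E * j) * partialInversion E 0 * T ^ (E * i)) 0 1 : ℤ) : ZMod N) =
      -E + E * (i * j) := by
  simp only [specialLinearGroup_mul_apply, T_zpow_apply_zero_zero, T_zpow_apply_zero_one,
    T_zpow_apply_one_one]
  push_cast
  rw [partialInversion_apply_zero_zero hE, partialInversion_apply_one_zero,
    partialInversion_apply_zero_one hE, partialInversion_apply_one_one hE]
  push_cast
  linear_combination (-j - i + E * i * j + i * j : ZMod N) * hE

namespace IsRowInvariant

theorem invertedTranslate_slash (hg : IsRowInvariant N k χ g) (hE : (E : ZMod N) * E = E)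
    (j i j' i' : ℤ) (u : ZMod N) (hu : IsUnit u)
    (h0 : (1 - E + E * j : ZMod N) = u * (1 - E + E * j'))
    (h1 : (-E + E * (i * j) : ZMod N) = u * (-E + E * (i' * j'))) :
    invertedTranslate k g E j ∣[k] (T ^ (E * i)) =
      χ u • invertedTranslate k g E j' ∣[k] (T ^ (E * i')) := by
  rw [invertedTranslate, invertedTranslate, ← SlashAction.slash_mul, ← SlashAction.slash_mul]
  refine hg _ _ u hu ?_ ?_
  · rw [translate_inversion_translate_apply_zero_zero hE,
      translate_inversion_translate_apply_zero_zero hE, h0]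
  · rw [translate_inversion_translate_apply_zero_one hE,
      translate_inversion_translate_apply_zero_one hE, h1]

/-- Both rows are (Q, -1) on the E-part, so the inversion belongs to the family W_j. -/
theorem slash_partialInversion (hg : IsRowInvariant N k χ g) (hE : (E : ZMod N) * E = E) (Q : ℤ) :
    g ∣[k] partialInversion E Q = invertedTranslate k g E Q := by
  have h : invertedTranslate k g E Q =
      g ∣[k] (T ^ (E * Q) * partialInversion E 0 * T ^ (E * 0)) := by
    rw [invertedTranslate, mul_zero, zpow_zero, mul_one]
  rw [h]
  refine hg.slash_eq ?_ ?_
  · rw [translate_inversion_translate_apply_zero_zero hE, partialInversion_apply_zero_zero hE]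
    ring
  · rw [translate_inversion_translate_apply_zero_one hE, partialInversion_apply_zero_one hE]
    push_cast
    ring

theorem invertedTranslate_congr (hg : IsRowInvariant N k χ g) (hE : (E : ZMod N) * E = E)
    {j j' : ℤ} (h : (E * j : ZMod N) = E * j') :
    invertedTranslate k g E j = invertedTranslate k g E j' := by
  rw [← slash_partialInversion hg hE, ← slash_partialInversion hg hE]
  refine hg.slash_eq ?_ ?_
  · rw [partialInversion_apply_zero_zero hE, partialInversion_apply_zero_zero hE]
    linear_combination h
  · rw [partialInversion_apply_zero_one hE, partialInversion_apply_zero_one hE]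

theorem isUnit_one_sub_add (hE : (E : ZMod N) * E = E) {j j' : ℤ}
    (h : (E * (j * j') : ZMod N) = E) : IsUnit (1 - E + E * j : ZMod N) :=
  IsUnit.of_mul_eq_one (1 - E + E * j' : ZMod N) (by
    linear_combination (1 - j - j' + j * j' : ZMod N) * hE + h)

/-- On the E-part (j, -1) = j(1, -j'), and off it both rows are (1, 0); the scalar is the unit equal
to j on the E-part and to 1 off it. -/
theorem invertedTranslate_of_unit (hg : IsRowInvariant N k χ g) (hE : (E : ZMod N) * E = E)
    {j j' : ℤ} (h : (E * (j * j') : ZMod N) = E) :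
    invertedTranslate k g E j = χ (1 - E + E * j) • g ∣[k] (T ^ (E * -j')) := by
  rw [← slash_partialInversion hg hE]
  refine hg _ _ _ (isUnit_one_sub_add hE h) ?_ ?_
  · rw [partialInversion_apply_zero_zero hE, T_zpow_apply_zero_zero]
    push_cast
    ring
  · rw [partialInversion_apply_zero_one hE, T_zpow_apply_zero_one]
    push_cast
    linear_combination (-j' + j * j' : ZMod N) * hE + h

theorem invertedTranslate_mem_of_unit (hg : IsRowInvariant N k χ g)
    (hE : (E : ZMod N) * E = E) {j j' : ℤ} (h : (E * (j * j') : ZMod N) = E) :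
    invertedTranslate k g E j ∈ translateSpan k g E := by
  rw [invertedTranslate_of_unit hg hE h]
  exact Submodule.smul_mem _ _ (Submodule.subset_span ⟨_, rfl⟩)

theorem sum_invertedTranslate {q : ℕ} {r : ℂ}
    (hrel : ∑ j ∈ Finset.range q, r ^ j • g ∣[k] (T ^ (E * (j : ℤ))) = 0) :
    ∑ j ∈ Finset.range q, r ^ j • invertedTranslate k g E j = 0 := by
  have := congrArg (fun x ↦ x ∣[k] partialInversion E 0) hrel
  simpa only [SlashAction.sum_slash, SlashAction.zero_slash, ModularForm.SL_smul_slash,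
    ← SlashAction.slash_mul, invertedTranslate] using this

theorem exists_mul_eq_of_isCoprime {q : ℕ} (hq : (q * E : ZMod N) = 0) {j : ℤ}
    (hj : IsCoprime j q) : ∃ j' : ℤ, (E * (j * j') : ZMod N) = E := by
  obtain ⟨a, b, hab⟩ := hj
  refine ⟨a, ?_⟩
  have : (a * j + b * q : ZMod N) = 1 := by exact_mod_cast congrArg (Int.cast (R := ZMod N)) hab
  linear_combination (E : ZMod N) * this - b * hq

/-- All inverted translates at a prime lie in the span of the translates. -/
theorem invertedTranslate_mem_of_prime (hg : IsRowInvariant N k χ g) (hE : (E : ZMod N) * E = E)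
    {p : ℕ} (hp : p.Prime) (hq : (p * E : ZMod N) = 0) {r : ℂ}
    (hrel : ∑ j ∈ Finset.range p, r ^ j • g ∣[k] (T ^ (E * (j : ℤ))) = 0) (j : ℤ) :
    invertedTranslate k g E j ∈ translateSpan k g E := by
  have hunit : ∀ j : ℤ, ¬ (p : ℤ) ∣ j → invertedTranslate k g E j ∈ translateSpan k g E := by
    intro j hj
    obtain ⟨j', hj'⟩ := exists_mul_eq_of_isCoprime hq
      (((Nat.prime_iff_prime_int.mp hp).coprime_iff_not_dvd.mpr hj).symm)
    exact invertedTranslate_mem_of_unit hg hE hj'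
  by_cases hj : (p : ℤ) ∣ j
  · obtain ⟨t, rfl⟩ := hj
    rw [invertedTranslate_congr hg hE (j' := 0) (by push_cast; linear_combination t * hq)]
    -- Every index in the relation except 0 is a unit mod p, and W_0 has coefficient 1, so the
    -- relation can be solved for W_0.
    have hsum := sum_invertedTranslate hrel
    obtain ⟨n, rfl⟩ : ∃ n, p = n + 1 := ⟨p - 1, by have := hp.pos; omega⟩
    rw [Finset.sum_range_succ'] at hsum
    simp only [pow_zero, one_smul, Nat.cast_zero] at hsum
    rw [eq_neg_of_add_eq_zero_right hsum]
    refine Submodule.neg_mem _ (Submodule.sum_mem _ fun i hi ↦ Submodule.smul_mem _ _ ?_)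
    refine hunit _ fun hdvd ↦ ?_
    have := Int.le_of_dvd (by positivity) hdvd
    have := Finset.mem_range.mp hi
    push_cast at *
    omega
  · exact hunit j hj

theorem invertedTranslate_mem_of_odd (hg : IsRowInvariant N k χ g) (hE : (E : ZMod N) * E = E)
    {v : ℕ} (hq : ((2 ^ v : ℕ) * E : ZMod N) = 0) {j : ℤ} (hj : Odd j) :
    invertedTranslate k g E j ∈ translateSpan k g E := by
  have hc : IsCoprime j ((2 ^ v : ℕ) : ℤ) := by
    push_cast
    refine IsCoprime.pow_right ?_
    obtain ⟨t, rfl⟩ := hj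
    exact ⟨1, -t, by ring⟩
  obtain ⟨j', hj'⟩ := exists_mul_eq_of_isCoprime hq hc
  exact invertedTranslate_mem_of_unit hg hE hj'

/-- All inverted translates at `4` lie in the span of the translates. -/
theorem invertedTranslate_mem_of_four (hg : IsRowInvariant N k χ g) (hE : (E : ZMod N) * E = E)
    (hq : (4 * E : ZMod N) = 0) (hχ : χ (1 - E + E * 3) = -1) {r : ℂ} (hr : r ^ 4 = 1)
    (hrel : ∑ j ∈ Finset.range 4, r ^ j • g ∣[k] (T ^ (E * (j : ℤ))) = 0) (j : ℤ) :
    invertedTranslate k g E j ∈ translateSpan k g E := by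
  have hodd := fun {j : ℤ} ↦ invertedTranslate_mem_of_odd (v := 2) hg hE (j := j)
    (by norm_num; exact hq)
  have hr0 : r ≠ 0 := by rintro rfl; norm_num at hr
  have hsum := sum_invertedTranslate hrel
  simp only [Finset.sum_range_succ, Finset.sum_range_zero, zero_add, pow_zero, one_smul, pow_one,
    Nat.cast_zero, Nat.cast_one, Nat.cast_ofNat] at hsum
  have h02 : invertedTranslate k g E 0 + r ^ 2 • invertedTranslate k g E 2 ∈
      translateSpan k g E := by
    have : invertedTranslate k g E 0 + r ^ 2 • invertedTranslate k g E 2 =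
        -(r • invertedTranslate k g E 1 + r ^ 3 • invertedTranslate k g E 3) := by
      rw [eq_neg_iff_add_eq_zero, ← hsum]; abel
    rw [this]
    exact Submodule.neg_mem _ (Submodule.add_mem _ (Submodule.smul_mem _ _ (hodd (by decide)))
      (Submodule.smul_mem _ _ (hodd (by decide))))
  have hu : IsUnit (1 - E + E * 3 : ZMod N) := by
    simpa using isUnit_one_sub_add (N := N) (j := 3) (j' := 3) hE
      (by push_cast; linear_combination 2 * hq)
  -- On the E-part T^E fixes (0, -1) and sends (2, -1) to (2, 1) = 3(2, -1) mod 4. So W_0 and W_2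
  -- have eigenvalues 1 and -1, and the known combination together with its translate separates
  -- them.
  have h0 : invertedTranslate k g E 0 ∣[k] (T ^ (E * 1)) = invertedTranslate k g E 0 := by
    simpa using invertedTranslate_slash hg hE 0 1 0 0 1 isUnit_one (by ring) (by push_cast; ring)
  have h2 : invertedTranslate k g E 2 ∣[k] (T ^ (E * 1)) = -invertedTranslate k g E 2 := by
    simpa [hχ] using invertedTranslate_slash hg hE 2 1 2 0 _ hu
      (by push_cast; linear_combination (-2) * hE - hq)
      (by push_cast; linear_combination 2 * hE + hq)
  have h02' := slash_T_zpow_mem_translateSpan h02 1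
  rw [SlashAction.add_slash, ModularForm.SL_smul_slash, h0, h2] at h02'
  have m0 : invertedTranslate k g E 0 ∈ translateSpan k g E := by
    have := Submodule.smul_mem _ (2⁻¹ : ℂ) (Submodule.add_mem _ h02 h02')
    convert this using 1
    module
  have m2 : invertedTranslate k g E 2 ∈ translateSpan k g E := by
    have := Submodule.smul_mem _ ((2 * r ^ 2)⁻¹ : ℂ) (Submodule.sub_mem _ h02 h02')
    convert this using 1
    match_scalars <;> field_simp <;> norm_num
  rcases Int.even_or_odd j with hj | hj
  · obtain ⟨t, rfl | rfl⟩ : ∃ t, j = 4 * t ∨ j = 4 * t + 2 := ⟨j / 4, by grind⟩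
    · rwa [invertedTranslate_congr hg hE (j' := 0) (by push_cast; linear_combination t * hq)]
    · rwa [invertedTranslate_congr hg hE (j' := 2) (by push_cast; linear_combination t * hq)]
  · exact hodd hj

/-- All inverted translates at `8` lie in the span of the translates. -/
theorem invertedTranslate_mem_of_eight (hg : IsRowInvariant N k χ g) (hE : (E : ZMod N) * E = E)
    (hq : (8 * E : ZMod N) = 0) (hχ : χ (1 - E + E * 5) = -1) (hχ₂ : χ.IsQuadratic) {r : ℂ}
    (hr : r ^ 8 = 1)
    (hrel : ∑ j ∈ Finset.range 8, r ^ j • g ∣[k] (T ^ (E * (j : ℤ))) = 0) (j : ℤ) :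
    invertedTranslate k g E j ∈ translateSpan k g E := by
  have hodd := fun {j : ℤ} ↦ invertedTranslate_mem_of_odd (v := 3) hg hE (j := j)
    (by norm_num; exact hq)
  have hr0 : r ≠ 0 := by rintro rfl; norm_num at hr
  have hsum := sum_invertedTranslate hrel
  simp only [Finset.sum_range_succ, Finset.sum_range_zero, zero_add, pow_zero, one_smul, pow_one,
    Nat.cast_zero, Nat.cast_one, Nat.cast_ofNat] at hsum
  set W := invertedTranslate k g E with hW
  have hcongr : ∀ {i i' : ℤ}, (E * i : ZMod N) = E * i' → W i = W i' := fun h ↦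
    invertedTranslate_congr hg hE h
  have hev : W 0 + r ^ 2 • W 2 + r ^ 4 • W 4 + r ^ 6 • W 6 ∈ translateSpan k g E := by
    have : W 0 + r ^ 2 • W 2 + r ^ 4 • W 4 + r ^ 6 • W 6 =
        -(r • W 1 + r ^ 3 • W 3 + r ^ 5 • W 5 + r ^ 7 • W 7) := by
      rw [eq_neg_iff_add_eq_zero, ← hsum]; abel
    rw [this]
    refine Submodule.neg_mem _ (Submodule.add_mem _ (Submodule.add_mem _ (Submodule.add_mem _ ?_ ?_)
      ?_) ?_) <;> exact Submodule.smul_mem _ _ (hodd (by decide))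
  have hu : IsUnit (1 - E + E * 5 : ZMod N) := by
    simpa using isUnit_one_sub_add (N := N) (j := 5) (j' := 5) hE
      (by push_cast; linear_combination 3 * hq)
  have hu' : IsUnit (1 - E + E * (-1) : ZMod N) := by
    have := isUnit_one_sub_add (N := N) (j := -1) (j' := -1) hE (by push_cast; ring)
    push_cast at this
    exact this
  obtain ⟨σ, hσ, hσ'⟩ : ∃ σ : ℂ, χ (1 - E + E * (-1)) = σ ∧ σ ^ 2 = 1 := by
    refine ⟨_, rfl, ?_⟩
    rcases hχ₂ (1 - E + E * (-1) : ZMod N) with h | h | h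
    · exact absurd h (hu'.map χ).ne_zero
    · rw [h]; norm_num
    · rw [h]; norm_num
  -- Modulo 8, T^(2E) fixes the rows of W_0 and W_4 and multiplies those of W_2 and W_6 by 5, which
  -- separates the two pairs. T^E in turn separates W_0 from W_4, whose row it multiplies by 5.
  -- Finally (6, -1) = -(2, 1) ties W_6 to W_2|T^E with factor σ.
  have h01 : W 0 ∣[k] (T ^ (E * 1)) = W 0 := by
    simpa using invertedTranslate_slash hg hE 0 1 0 0 1 isUnit_one (by ring) (by push_cast; ring)
  have h02 : W 0 ∣[k] (T ^ (E * 2)) = W 0 := by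
    simpa using invertedTranslate_slash hg hE 0 2 0 0 1 isUnit_one (by ring) (by push_cast; ring)
  have h41 : W 4 ∣[k] (T ^ (E * 1)) = -W 4 := by
    simpa [hχ] using invertedTranslate_slash hg hE 4 1 4 0 _ hu
      (by push_cast; linear_combination (-12) * hE - 2 * hq)
      (by push_cast; linear_combination 4 * hE + hq)
  have h42 : W 4 ∣[k] (T ^ (E * 2)) = W 4 := by
    simpa using invertedTranslate_slash hg hE 4 2 4 0 1 isUnit_one (by ring)
      (by push_cast; linear_combination hq)
  have h22 : W 2 ∣[k] (T ^ (E * 2)) = -W 2 := by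
    simpa [hχ] using invertedTranslate_slash hg hE 2 2 2 0 _ hu
      (by push_cast; linear_combination (-4) * hE - hq)
      (by push_cast; linear_combination 4 * hE + hq)
  have h62 : W 6 ∣[k] (T ^ (E * 2)) = -W 6 := by
    simpa [hχ] using invertedTranslate_slash hg hE 6 2 6 0 _ hu
      (by push_cast; linear_combination (-20) * hE - 3 * hq)
      (by push_cast; linear_combination 4 * hE + 2 * hq)
  have h60 : W 6 = σ • W 2 ∣[k] (T ^ (E * 1)) := by
    have h := invertedTranslate_slash hg hE 6 0 2 1 _ hu'
      (by push_cast; linear_combination 2 * hE + hq)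
      (by push_cast; linear_combination 2 * hE)
    rw [hσ] at h
    simpa using h
  have h61 : W 6 ∣[k] (T ^ (E * 1)) = -(σ • W 2) := by
    rw [h60, ModularForm.SL_smul_slash, ← SlashAction.slash_mul, ← zpow_add, ← mul_add,
      one_add_one_eq_two, h22, smul_neg]
  have hev2 := slash_T_zpow_mem_translateSpan hev 2
  simp only [SlashAction.add_slash, ModularForm.SL_smul_slash, h02, h22, h42, h62] at hev2
  have m04 : W 0 + r ^ 4 • W 4 ∈ translateSpan k g E := by
    convert Submodule.smul_mem _ (2⁻¹ : ℂ) (Submodule.add_mem _ hev hev2) using 1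
    module
  have m26 : r ^ 2 • W 2 + r ^ 6 • W 6 ∈ translateSpan k g E := by
    convert Submodule.smul_mem _ (2⁻¹ : ℂ) (Submodule.sub_mem _ hev hev2) using 1
    module
  have m04' := slash_T_zpow_mem_translateSpan m04 1
  simp only [SlashAction.add_slash, ModularForm.SL_smul_slash, h01, h41] at m04'
  have m0 : W 0 ∈ translateSpan k g E := by
    convert Submodule.smul_mem _ (2⁻¹ : ℂ) (Submodule.add_mem _ m04 m04') using 1
    module
  have m4 : W 4 ∈ translateSpan k g E := by
    convert Submodule.smul_mem _ ((2 * r ^ 4)⁻¹ : ℂ) (Submodule.sub_mem _ m04 m04') using 1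
    match_scalars <;> field_simp <;> norm_num
  have m26' := slash_T_zpow_mem_translateSpan m26 1
  -- With V = W_2|T^E, the span contains r²W_2 + r⁶σV and r²V - r⁶σW_2. The determinant is r⁴ +
  -- r¹²σ² = 2r⁴, because r⁸ = σ² = 1.
  have m2 : W 2 ∈ translateSpan k g E := by
    rw [SlashAction.add_slash, ModularForm.SL_smul_slash, ModularForm.SL_smul_slash, h61] at m26'
    rw [h60] at m26
    have h := Submodule.smul_mem _ ((2 * r ^ 4)⁻¹ : ℂ) (Submodule.sub_mem _
      (Submodule.smul_mem _ (r ^ 2) m26) (Submodule.smul_mem _ (r ^ 6 * σ) m26'))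
    convert h using 1
    have : r ^ 4 ≠ 0 := pow_ne_zero _ hr0
    match_scalars
    · field_simp
      linear_combination (-r ^ 8) * hσ' - hr
    · field_simp
      ring
  have m6 : W 6 ∈ translateSpan k g E := by
    rw [h60]; exact Submodule.smul_mem _ _ (slash_T_zpow_mem_translateSpan m2 1)
  rcases Int.even_or_odd j with hj | hj
  · obtain ⟨t, rfl | rfl | rfl | rfl⟩ :
        ∃ t, j = 8 * t ∨ j = 8 * t + 2 ∨ j = 8 * t + 4 ∨ j = 8 * t + 6 := ⟨j / 8, by grind⟩
    · rwa [hcongr (i' := 0) (by push_cast; linear_combination t * hq)]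
    · rwa [hcongr (i' := 2) (by push_cast; linear_combination t * hq)]
    · rwa [hcongr (i' := 4) (by push_cast; linear_combination t * hq)]
    · rwa [hcongr (i' := 6) (by push_cast; linear_combination t * hq)]
  · exact hodd hj

end IsRowInvariant

end translates

/-! ### Rescaling to level structure Γ⁰(N) and factoring the cusp matrix. -/

/-- The matrix `diag(1/N, 1)`. -/
noncomputable def levelScaling (N : ℕ) [NeZero N] : GL (Fin 2) ℝ :=
  .mkOfDetNeZero !![(N : ℝ)⁻¹, 0; 0, 1] (by simp [NeZero.ne])

theorem coe_levelScaling (N : ℕ) [NeZero N] :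
    (levelScaling N : Matrix (Fin 2) (Fin 2) ℝ) = !![(N : ℝ)⁻¹, 0; 0, 1] := rfl

/-- The upper triangular matrix with rows `(m, 1)` and `(0, Q)`. -/
noncomputable def cuspTriangular (m Q : ℕ) [NeZero m] [NeZero Q] : GL (Fin 2) ℝ :=
  .mkOfDetNeZero !![(m : ℝ), 1; 0, (Q : ℝ)] (by simp [NeZero.ne])

theorem coe_cuspTriangular (m Q : ℕ) [NeZero m] [NeZero Q] :
    (cuspTriangular m Q : Matrix (Fin 2) (Fin 2) ℝ) = !![(m : ℝ), 1; 0, (Q : ℝ)] := rfl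

/-- The matrix with rows `(1, 0)` and `(m, 1)`, which maps `∞` to `1/m`. -/
def lowerUnipotent (m : ℤ) : SL(2, ℤ) :=
  ⟨!![1, 0; m, 1], by rw [Matrix.det_fin_two_of]; ring⟩

theorem coe_lowerUnipotent (m : ℤ) :
    (lowerUnipotent m : Matrix (Fin 2) (Fin 2) ℤ) = !![1, 0; m, 1] := rfl

theorem coe_partialInversion_one (Q : ℤ) :
    (partialInversion 1 Q : Matrix (Fin 2) (Fin 2) ℤ) = !![Q, -1; 1, 0] := by
  have : (partialInversion 1 Q : Matrix (Fin 2) (Fin 2) ℤ) =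
    !![1 + (Q - 1) * 1 ^ 2, (Q - 1) * 1 - 1 - (Q - 1) * 1 ^ 3; 1, 1 - 1 ^ 2] := rfl
  rw [this]
  congr <;> ring_nf

theorem lowerUnipotent_eq {N m Q : ℕ} [NeZero N] [NeZero m] [NeZero Q] (h : m * Q = N) :
    mapGL ℝ (lowerUnipotent m) =
      levelScaling N * mapGL ℝ (partialInversion 1 Q) * cuspTriangular m Q := by
  have hN : (N : ℝ) = m * Q := by exact_mod_cast h.symm
  have hm : (m : ℝ) ≠ 0 := by exact_mod_cast NeZero.ne m
  have hQ : (Q : ℝ) ≠ 0 := by exact_mod_cast NeZero.ne Q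
  have hmap : ∀ a b c d : ℤ, (!![a, b; c, d]).map (algebraMap ℤ ℝ) =
      !![(a : ℝ), (b : ℝ); (c : ℝ), (d : ℝ)] := by
    intro a b c d
    ext i j
    fin_cases i <;> fin_cases j <;> rfl
  apply Units.ext
  simp only [Matrix.GeneralLinearGroup.coe_mul, coe_levelScaling, coe_cuspTriangular,
    mapGL_coe_matrix, map_apply_coe, RingHom.mapMatrix_apply, coe_partialInversion_one,
    coe_lowerUnipotent, hmap, Matrix.mul_fin_two, hN]
  congr 1
  push_cast
  field_simp
  simp
  rw [div_self (mul_ne_zero hm hQ)]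

theorem slash_lowerUnipotent {N m Q : ℕ} [NeZero N] [NeZero m] [NeZero Q] (h : m * Q = N)
    (k : ℤ) (f : ℍ → ℂ) :
    f ∣[k] lowerUnipotent m =
      ((f ∣[k] levelScaling N) ∣[k] partialInversion 1 Q) ∣[k] cuspTriangular m Q := by
  change f ∣[k] mapGL ℝ (lowerUnipotent m) =
    ((f ∣[k] levelScaling N) ∣[k] mapGL ℝ (partialInversion 1 Q)) ∣[k] cuspTriangular m Q
  rw [lowerUnipotent_eq h, SlashAction.slash_mul, SlashAction.slash_mul]

/-- If the first rows differ by the factor u, then γ'γ⁻¹ is lower triangular mod N with diagonal (u,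
u⁻¹). Conjugation by diag(1/N, 1) moves it into Γ₀(N) with the same diagonal, and χ(u⁻¹) = χ(u)
because χ is quadratic. -/
theorem isRowInvariant_slash_levelScaling {N : ℕ} [NeZero N] {k : ℤ} {χ : DirichletCharacter ℂ N}
    (hχ₂ : χ.IsQuadratic) {f : ℍ → ℂ}
    (hf : ∀ M ∈ CongruenceSubgroup.Gamma0 N, f ∣[k] M = χ ((M 1 1 : ℤ) : ZMod N) • f) :
    IsRowInvariant N k χ (f ∣[k] levelScaling N) := by
  intro γ γ' u hu h0 h1
  obtain ⟨B, hB⟩ : ∃ B : SL(2, ℤ), B = γ' * γ⁻¹ := ⟨_, rfl⟩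
  have hγ' : γ' = B * γ := by rw [hB, inv_mul_cancel_right]
  have hdetγ : (γ 0 0 : ZMod N) * (γ 1 1 : ℤ) - (γ 0 1 : ℤ) * (γ 1 0 : ℤ) = 1 := by
    have := γ.2
    rw [Matrix.det_fin_two] at this
    exact_mod_cast congrArg (Int.cast (R := ZMod N)) this
  have hB00 : ((B 0 0 : ℤ) : ZMod N) = u := by
    have : B 0 0 = γ' 0 0 * γ 1 1 - γ' 0 1 * γ 1 0 := by
      rw [hB, specialLinearGroup_mul_apply, SL2_inv_expl]
      simp; ring
    rw [this]; push_cast; rw [h0, h1]; linear_combination u * hdetγ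
  have hB01 : ((B 0 1 : ℤ) : ZMod N) = 0 := by
    have : B 0 1 = -γ' 0 0 * γ 0 1 + γ' 0 1 * γ 0 0 := by
      rw [hB, specialLinearGroup_mul_apply, SL2_inv_expl]
      simp
    rw [this]; push_cast; rw [h0, h1]; ring
  have hdetB : B 0 0 * B 1 1 - B 0 1 * B 1 0 = 1 := by
    have := B.2
    rwa [Matrix.det_fin_two] at this
  have hχu : χ ((B 1 1 : ℤ) : ZMod N) = χ u := by
    have h : u * ((B 1 1 : ℤ) : ZMod N) = 1 := by
      have := congrArg (Int.cast (R := ZMod N)) hdetB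
      push_cast at this
      rw [hB00, hB01] at this
      linear_combination this
    have h2 : χ u * χ ((B 1 1 : ℤ) : ZMod N) = 1 := by rw [← map_mul, h, map_one]
    rcases hχ₂ u with h3 | h3 | h3 <;> rw [h3] at h2 ⊢
    · simp at h2
    · simpa using h2
    · linear_combination -h2
  obtain ⟨b, hb⟩ := (ZMod.intCast_zmod_eq_zero_iff_dvd _ N).mp hB01
  obtain ⟨B', hB'⟩ : ∃ B' : SL(2, ℤ), (B' : Matrix (Fin 2) (Fin 2) ℤ) =
      !![B 0 0, b; B 1 0 * N, B 1 1] :=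
    ⟨⟨_, by rw [Matrix.det_fin_two_of]; rw [hb] at hdetB; linear_combination hdetB⟩, rfl⟩
  have hcomm : levelScaling N * mapGL ℝ B = mapGL ℝ B' * levelScaling N := by
    have hN : (N : ℝ) ≠ 0 := by exact_mod_cast NeZero.ne N
    have hb' : ((B 0 1 : ℤ) : ℝ) = N * b := by exact_mod_cast hb
    ext i j
    simp only [Matrix.GeneralLinearGroup.coe_mul, coe_levelScaling, mapGL_coe_matrix,
      map_apply_coe, hB']
    fin_cases i <;> fin_cases j <;> simp [Matrix.mul_apply, Fin.sum_univ_two, hb'] <;> field_simp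
  have hB'mem : B' ∈ CongruenceSubgroup.Gamma0 N := by
    rw [CongruenceSubgroup.Gamma0_mem, hB']
    simp
  have hfB := hf B' hB'mem
  have hB'11 : B' 1 1 = B 1 1 := by rw [hB']; rfl
  rw [hB'11, hχu] at hfB
  have hgB : (f ∣[k] levelScaling N) ∣[k] B = χ u • f ∣[k] levelScaling N := by
    change (f ∣[k] levelScaling N) ∣[k] mapGL ℝ B = _
    change f ∣[k] mapGL ℝ B' = _ at hfB
    rw [← SlashAction.slash_mul, hcomm, SlashAction.slash_mul, hfB, ModularForm.smul_slash, σ, if_pos]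
    · rfl
    · rw [Matrix.GeneralLinearGroup.val_det_apply, coe_levelScaling, Matrix.det_fin_two_of]
      have : (0 : ℝ) < N := by exact_mod_cast Nat.pos_of_ne_zero (NeZero.ne N)
      simpa using this
  rw [hγ', SlashAction.slash_mul, hgB, ModularForm.SL_smul_slash]

/-- Passing from `q`-expansions of `f` to those of `τ ↦ f(τ/N)`. -/
theorem HasFourierExpansion.slash_levelScaling {N : ℕ} [NeZero N] (k : ℤ) {f : ℍ → ℂ} {a : ℤ → ℂ}
    (ha : HasFourierExpansion 1 f a) : ∃ C : ℂ, C ≠ 0 ∧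
      HasFourierExpansion N (f ∣[k] levelScaling N) (fun n ↦ C * a n) := by
  have hN : (0 : ℝ) < N := by exact_mod_cast Nat.pos_of_ne_zero (NeZero.ne N)
  obtain ⟨C, hC, h⟩ := exists_slash_triangular k (N : ℝ)⁻¹ 0 1 (by positivity) one_pos
    (levelScaling N) (coe_levelScaling N)
  refine ⟨C, hC, ?_, fun τ ↦ ?_⟩
  · obtain ⟨⟨n₀, hn₀⟩, -⟩ := ha
    exact ⟨n₀, fun n hn ↦ by simp [hn₀ n hn]⟩
  · obtain ⟨τ', hτ', h⟩ := h τ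
    rw [h]
    have hq : Function.Periodic.qParam ((1 : ℕ) : ℝ) τ' = Function.Periodic.qParam (N : ℝ) τ := by
      rw [Function.Periodic.qParam, Function.Periodic.qParam, hτ']
      congr 1
      push_cast
      field_simp
      ring
    simpa only [hq, mul_assoc] using (ha.2 τ').mul_left C

/-- Passing from the expansion of `G` in `e^(2πi τ / N)` to that of `τ ↦ G((mτ + 1) / Q)`. -/
theorem HasFourierExpansion.slash_cuspTriangular {N m Q : ℕ} [NeZero N] [NeZero m] [NeZero Q]
    (h : m * Q = N) (k : ℤ) {G : ℍ → ℂ} {c : ℤ → ℂ} (hG : HasFourierExpansion N G c)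
    (hc : ∀ n, ¬ (Q : ℤ) ∣ n → c n = 0) : ∃ ρ : ℤ → ℂ, (∀ n, ρ n ≠ 0) ∧
      HasFourierExpansion Q (G ∣[k] cuspTriangular m Q) (fun n ↦ ρ n * c (n * Q)) := by
  have hm : (0 : ℝ) < m := by exact_mod_cast Nat.pos_of_ne_zero (NeZero.ne m)
  have hQ : (0 : ℝ) < Q := by exact_mod_cast Nat.pos_of_ne_zero (NeZero.ne Q)
  have hQ' : (0 : ℤ) < Q := by exact_mod_cast Nat.pos_of_ne_zero (NeZero.ne Q)
  obtain ⟨C, hC, hval⟩ := exists_slash_triangular k m 1 Q hm hQ (cuspTriangular m Q)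
    (coe_cuspTriangular m Q)
  refine ⟨fun n ↦ C * Function.Periodic.qParam (N : ℝ) 1 ^ n, fun n ↦ mul_ne_zero hC
    (zpow_ne_zero _ (Function.Periodic.qParam_ne_zero _)), ?_, fun τ ↦ ?_⟩
  · obtain ⟨⟨n₀, hn₀⟩, -⟩ := hG
    -- For n < 0 one has nQ ≤ n, so n < min n₀ 0 gives nQ < n₀.
    refine ⟨min n₀ 0, fun n hn ↦ ?_⟩
    have h1 : n < n₀ := hn.trans_le (min_le_left _ _)
    have h2 : n < 0 := hn.trans_le (min_le_right _ _)
    have : n * Q < n₀ := by nlinarith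
    simp [hn₀ _ this]
  · obtain ⟨τ', hτ', hval⟩ := hval τ
    rw [hval]
    have hinj : Function.Injective fun n : ℤ ↦ n * (Q : ℤ) := fun a b hab ↦
      mul_right_cancel₀ hQ'.ne' hab
    have h1 := ((hinj.hasSum_iff fun n hn ↦ by
      rw [hc n fun ⟨t, ht⟩ ↦ hn ⟨t, by simp [ht, mul_comm]⟩, zero_mul]).mpr (hG.2 τ')).mul_left C
    have hq : Function.Periodic.qParam (N : ℝ) τ' ^ (Q : ℤ) =
        Function.Periodic.qParam (N : ℝ) 1 * Function.Periodic.qParam (Q : ℝ) τ := by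
      have hN : ((N : ℝ) : ℂ) = m * Q := by rw [← h]; push_cast; ring
      have hm' : (m : ℂ) ≠ 0 := by exact_mod_cast hm.ne'
      have hQ'' : (Q : ℂ) ≠ 0 := by exact_mod_cast hQ.ne'
      rw [Function.Periodic.qParam, Function.Periodic.qParam, Function.Periodic.qParam, hτ', hN,
        ← Complex.exp_int_mul, ← Complex.exp_add]
      congr 1
      push_cast
      field_simp
      ring
    refine h1.congr_fun ?_
    intro n
    simp only [Function.comp_apply]
    rw [mul_comm n, zpow_mul, hq, mul_zpow]
    ring

/-! ### Chinese remainder idempotents. -/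

/-- An integer that is `1` modulo the `p`-part of `N` and `0` modulo the prime-to-`p` part. -/
noncomputable def primeIdempotent (N : ℕ) (p : N.primeFactors) : ℤ :=
  ((primeSplitting N p).symm (1, 0)).cast

section primeIdempotent

variable {N : ℕ} (p : N.primeFactors)

theorem coe_primeIdempotent :
    (primeIdempotent N p : ZMod N) = (primeSplitting N p).symm (1, 0) :=
  ZMod.intCast_zmod_cast _

theorem primeSplitting_primeIdempotent : primeSplitting N p (primeIdempotent N p) = (1, 0) := by
  rw [coe_primeIdempotent, RingEquiv.apply_symm_apply]

theorem primeIdempotent_mul_self :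
    (primeIdempotent N p : ZMod N) * primeIdempotent N p = primeIdempotent N p := by
  apply (primeSplitting N p).injective
  rw [map_mul, primeSplitting_primeIdempotent]
  simp

theorem primeIdempotent_mul_eq_zero_iff (n : ℤ) :
    (primeIdempotent N p * n : ZMod N) = 0 ↔ ((p ^ N.factorization p : ℕ) : ℤ) ∣ n := by
  rw [← (primeSplitting N p).map_eq_zero_iff, map_mul, primeSplitting_primeIdempotent,
    map_intCast, ← ZMod.intCast_zmod_eq_zero_iff_dvd]
  simp [Prod.ext_iff]

theorem one_sub_primeIdempotent_mul_eq_zero :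
    (1 - primeIdempotent N p : ZMod N) * (N / p ^ N.factorization p : ℕ) = 0 := by
  apply (primeSplitting N p).injective
  rw [map_mul, map_sub, map_one, primeSplitting_primeIdempotent, map_natCast, map_zero]
  ext <;> simp

/-- Identifies the scalars met when comparing rows at p as values of χ_p. -/
theorem primeComponent_intCast (χ : DirichletCharacter ℂ N) (n : ℤ) :
    primeComponent χ p n = χ (1 - primeIdempotent N p + primeIdempotent N p * n) := by
  change χ ((primeSplitting N p).symm (n, 1)) = _
  congr 1
  rw [RingEquiv.symm_apply_eq, map_add, map_sub, map_mul, primeSplitting_primeIdempotent,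
    map_intCast, map_one]
  ext <;> simp

theorem primeIdempotent_mul_of_ne {p p' : N.primeFactors} (h : p ≠ p') :
    (primeIdempotent N p : ZMod N) * primeIdempotent N p' = 0 := by
  rw [primeIdempotent_mul_eq_zero_iff, ← ZMod.intCast_zmod_eq_zero_iff_dvd]
  set q := (p : ℕ) ^ N.factorization p
  set q' := (p' : ℕ) ^ N.factorization p'
  have hdvd : q ∣ N := Nat.ordProj_dvd N p
  have h1 : (q' : ZMod q) * (primeIdempotent N p' : ZMod q) = 0 := by
    have h2 : (primeIdempotent N p' * (q' : ℤ) : ZMod N) = 0 :=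
      (primeIdempotent_mul_eq_zero_iff p' q').mpr dvd_rfl
    have h3 := congrArg (ZMod.castHom hdvd (ZMod q)) h2
    rw [map_mul, map_intCast, map_intCast, map_zero] at h3
    rw [mul_comm]
    exact_mod_cast h3
  have hu : IsUnit (q' : ZMod q) := by
    rw [ZMod.isUnit_iff_coprime]
    refine Nat.Coprime.pow _ _ ((Nat.coprime_primes (Nat.prime_of_mem_primeFactors p'.2)
      (Nat.prime_of_mem_primeFactors p.2)).mpr fun h' ↦ h (Subtype.ext h'.symm))
  exact hu.mul_right_eq_zero.mp h1

theorem sum_primeIdempotent_mul_self (s : Finset N.primeFactors) :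
    (∑ p ∈ s, primeIdempotent N p : ZMod N) * (∑ p ∈ s, primeIdempotent N p : ZMod N) =
      ∑ p ∈ s, (primeIdempotent N p : ZMod N) := by
  rw [Finset.sum_mul_sum]
  refine Finset.sum_congr rfl fun p hp ↦ ?_
  rw [Finset.sum_eq_single_of_mem p hp fun p' _ h ↦ primeIdempotent_mul_of_ne h.symm,
    primeIdempotent_mul_self]

theorem primeIdempotent_mul_sum_of_notMem {s : Finset N.primeFactors} {p : N.primeFactors}
    (hp : p ∉ s) : (primeIdempotent N p : ZMod N) * (∑ p ∈ s, primeIdempotent N p : ZMod N) = 0 := by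
  rw [Finset.mul_sum]
  exact Finset.sum_eq_zero fun p' hp' ↦ primeIdempotent_mul_of_ne fun h ↦ hp (h ▸ hp')

theorem sum_primeIdempotent (hN : N ≠ 0) :
    (∑ p : N.primeFactors, (primeIdempotent N p : ZMod N)) = 1 := by
  have hdvd : ∀ p : N.primeFactors,
      ((p ^ N.factorization p : ℕ) : ℤ) ∣ (∑ p' : N.primeFactors, primeIdempotent N p') - 1 := by
    intro p
    rw [← primeIdempotent_mul_eq_zero_iff]
    push_cast
    rw [mul_sub, Finset.mul_sum, Finset.sum_eq_single_of_mem p (Finset.mem_univ _)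
      fun p' _ h ↦ primeIdempotent_mul_of_ne h.symm, primeIdempotent_mul_self]
    ring
  have hN' : (N : ℤ) ∣ (∑ p' : N.primeFactors, primeIdempotent N p') - 1 := by
    have hprod : (N : ℤ) = ∏ p : N.primeFactors, ((p ^ N.factorization p : ℕ) : ℤ) := by
      have h1 := Nat.prod_factorization_pow_eq_self hN
      rw [Finsupp.prod, Nat.support_factorization, ← Finset.prod_coe_sort] at h1
      exact_mod_cast h1.symm
    rw [hprod]
    refine Finset.prod_dvd_of_coprime (fun p _ p' _ h ↦ ?_) fun p _ ↦ hdvd p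
    refine Nat.isCoprime_iff_coprime.mpr (Nat.Coprime.pow _ _ ((Nat.coprime_primes
      (Nat.prime_of_mem_primeFactors p.2) (Nat.prime_of_mem_primeFactors p'.2)).mpr
        fun h' ↦ h (Subtype.ext h')))
  have := (ZMod.intCast_zmod_eq_zero_iff_dvd _ N).mpr hN'
  push_cast at this
  linear_combination this

end primeIdempotent

/-! ### Conductors of primitive quadratic characters. -/

section conductor

variable {N : ℕ} {χ : DirichletCharacter ℂ N}

/-- The `p`-component of a primitive quadratic character takes the value `-1` at some integer
that is `1` modulo the `p`-part of `N` divided by `p`. -/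
theorem exists_primeComponent_eq_neg_one [NeZero N] (hχ : χ.IsPrimitive) (hχ₂ : χ.IsQuadratic)
    (p : N.primeFactors) : ∃ x : ℤ, ((p ^ (N.factorization p - 1) : ℕ) : ℤ) ∣ x - 1 ∧
      primeComponent χ p x = -1 := by
  have hp := Nat.prime_of_mem_primeFactors p.2
  have hpN : (p : ℕ) ∣ N := Nat.dvd_of_mem_primeFactors p.2
  have hN : 0 < N := Nat.pos_of_ne_zero (NeZero.ne N)
  have hv : 0 < N.factorization p := hp.factorization_pos_of_dvd hN.ne' hpN
  obtain ⟨v, hv⟩ : ∃ v, N.factorization p = v + 1 := ⟨_, (Nat.succ_pred_eq_of_pos hv).symm⟩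
  have hqN : (p : ℕ) ^ N.factorization p ∣ N := Nat.ordProj_dvd N p
  have hNp : N / p = p ^ (N.factorization p - 1) * (N / p ^ N.factorization p) := by
    refine Nat.div_eq_of_eq_mul_left hp.pos ?_
    conv_lhs => rw [← Nat.mul_div_cancel' hqN]
    rw [hv, Nat.add_sub_cancel, pow_succ]
    ring
  have hd : N / p ∣ N := Nat.div_dvd_of_dvd hpN
  -- Otherwise the conductor N would divide N/p. Hence some unit y ≡ 1 mod N/p has χ(y) ≠ 1, that
  -- is, χ(y) = -1.
  have hnot : ¬ χ.FactorsThrough (N / p) := by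
    intro h
    have h1 := DirichletCharacter.conductor_le_conductor_mem_conductorSet (d := N / p) h
    have h2 := DirichletCharacter.conductor_dvd_of_mem_conductorSet χ (d := N / p) h
    rw [(DirichletCharacter.isPrimitive_def χ).mp hχ] at h2
    have h3 := Nat.le_of_dvd (Nat.div_pos (Nat.le_of_dvd hN hpN) hp.pos) h2
    exact absurd (Nat.div_lt_self hN hp.one_lt) (not_lt.mpr h3)
  rw [DirichletCharacter.factorsThrough_iff_ker_unitsMap hd, SetLike.le_def] at hnot
  push Not at hnot
  obtain ⟨y, hy, hy'⟩ := hnot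
  have hχy : χ y = -1 := by
    rcases hχ₂ y with h | h | h
    · exact absurd h (y.isUnit.map χ).ne_zero
    · refine absurd ?_ hy'
      rw [MonoidHom.mem_ker]
      ext
      simpa using h
    · exact h
  obtain ⟨x, hx⟩ := ZMod.intCast_surjective (y : ZMod N)
  have hdvd : ((N / p : ℕ) : ℤ) ∣ x - 1 := by
    rw [← ZMod.intCast_zmod_eq_zero_iff_dvd]
    rw [MonoidHom.mem_ker] at hy
    have h1 := congrArg (Units.val) hy
    rw [ZMod.unitsMap_val, ← hx, Units.val_one] at h1
    have h2 : ((x : ZMod N).cast : ZMod (N / p)) = x := by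
      rw [← ZMod.castHom_apply (h := hd), map_intCast]
    push_cast
    rw [← h2, h1, sub_self]
  refine ⟨x, (Int.natCast_dvd_natCast.mpr ⟨_, hNp⟩).trans hdvd, ?_⟩
  rw [primeComponent_intCast, ← hχy, ← hx]
  congr 1
  obtain ⟨t, ht⟩ := hdvd
  have hxt : (x : ZMod N) = 1 + (p ^ (N.factorization p - 1) : ℕ) *
      (N / p ^ N.factorization p : ℕ) * t := by
    have h1 : x = 1 + ((N / p : ℕ) : ℤ) * t := by linarith
    have h2 := congrArg (Int.cast (R := ZMod N)) h1
    rw [hNp] at h2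
    simpa only [Int.cast_add, Int.cast_one, Int.cast_mul, Int.cast_natCast, Nat.cast_mul] using h2
  rw [hxt]
  linear_combination (-(p ^ (N.factorization p - 1) : ℕ) * t : ZMod N) *
    one_sub_primeIdempotent_mul_eq_zero p

theorem primeComponent_eq_of_dvd_sub (p : N.primeFactors) {x y : ℤ}
    (h : ((p ^ N.factorization p : ℕ) : ℤ) ∣ x - y) : primeComponent χ p x = primeComponent χ p y := by
  congr 1
  rw [← sub_eq_zero, ← Int.cast_sub, ZMod.intCast_zmod_eq_zero_iff_dvd]
  exact h

/-- The conductor of a primitive quadratic character: odd primes divide it exactly once, and its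
`2`-part is `1`, `4` or `8`. -/
theorem factorization_cases [NeZero N] (hχ : χ.IsPrimitive) (hχ₂ : χ.IsQuadratic) (p : N.primeFactors) :
    ((p : ℕ) ≠ 2 ∧ N.factorization p = 1) ∨
    ((p : ℕ) = 2 ∧ N.factorization p = 2 ∧ primeComponent χ p (3 : ℤ) = -1) ∨
    ((p : ℕ) = 2 ∧ N.factorization p = 3 ∧ primeComponent χ p (5 : ℤ) = -1) := by
  have hp := Nat.prime_of_mem_primeFactors p.2
  have hpN : (p : ℕ) ∣ N := Nat.dvd_of_mem_primeFactors p.2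
  have hv : 0 < N.factorization p := hp.factorization_pos_of_dvd (NeZero.ne N) hpN
  obtain ⟨x, hx, hχx⟩ := exists_primeComponent_eq_neg_one hχ hχ₂ p
  obtain ⟨r, hr⟩ : ∃ v, N.factorization p = v + 1 := ⟨_, (Nat.succ_pred_eq_of_pos hv).symm⟩
  rw [hr, Nat.add_sub_cancel] at hx
  have hcongr : ∀ {y : ℤ}, ((p ^ (r + 1) : ℕ) : ℤ) ∣ x - y → primeComponent χ p y = -1 :=
    fun {y} h ↦ by rw [← hχx]; exact (primeComponent_eq_of_dvd_sub p (hr ▸ h)).symm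
  have hone : ¬ ((p ^ (r + 1) : ℕ) : ℤ) ∣ x - 1 := by
    intro h
    have := hcongr h
    rw [Int.cast_one, map_one] at this
    norm_num at this
  obtain ⟨t, ht⟩ := hx
  by_cases hp2 : (p : ℕ) = 2
  · right
    rw [hp2] at ht hone
    replace hcongr : ∀ {y : ℤ}, ((2 ^ (r + 1) : ℕ) : ℤ) ∣ x - y → primeComponent χ p y = -1 :=
      fun {y} h ↦ hcongr (by rw [hp2]; exact h)
    -- Here x ≡ 1 mod 2^r but not mod 2^(r+1). For r = 0 this makes x even, where χ₂ vanishes; r = 1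
    -- gives x ≡ 3 mod 4 and r = 2 gives x ≡ 5 mod 8. For r ≥ 3, x is congruent to the square of 1 +
    -- 2^(r-1)t, where a character with values 0, ±1 cannot be -1.
    refine (show r = 0 ∨ r = 1 ∨ r = 2 ∨ 3 ≤ r by omega).elim ?_ ?_
    · rintro rfl
      exfalso
      rcases Int.even_or_odd x with he | ho
      · have h0 := hcongr (y := 0) (by simpa using he.two_dvd)
        have hq : (p : ℕ) ^ N.factorization p ≠ 1 := by rw [hr, hp2]; norm_num
        have : Nontrivial (ZMod ((p : ℕ) ^ N.factorization p)) := ZMod.nontrivial_iff.mpr hq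
        rw [Int.cast_zero, MulChar.map_zero] at h0
        norm_num at h0
      · refine hone ?_
        obtain ⟨t, rfl⟩ := ho
        exact ⟨t, by push_cast; ring⟩
    rintro (rfl | rfl | h3)
    · left
      refine ⟨hp2, hr, hcongr ?_⟩
      norm_num at ht hone ⊢
      omega
    · right
      refine ⟨hp2, hr, hcongr ?_⟩
      norm_num at ht hone ⊢
      omega
    · exfalso
      have hsq := hcongr (y := (1 + 2 ^ (r - 1) * t) ^ 2) ?_
      · rw [Int.cast_pow, map_pow] at hsq
        have hquad : ∀ z : ℤ, primeComponent χ p z = 0 ∨ primeComponent χ p z = 1 ∨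
            primeComponent χ p z = -1 := fun z ↦ by
          rw [primeComponent_intCast]; exact hχ₂ _
        rcases hquad (1 + 2 ^ (r - 1) * t) with h | h | h <;> rw [h] at hsq <;> norm_num at hsq
      · obtain ⟨w, rfl⟩ : ∃ w, r = w + 3 := ⟨r - 3, by omega⟩
        refine ⟨-(2 ^ w * t ^ 2), ?_⟩
        rw [show w + 3 - 1 = w + 2 by omega]
        push_cast at ht ⊢
        linear_combination ht
  · left
    refine ⟨hp2, ?_⟩
    by_contra hr1
    obtain ⟨w, rfl⟩ : ∃ w, r = w + 1 := ⟨r - 1, by omega⟩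
    -- From x ≡ 1 mod p^(w+1) follows x^p ≡ 1 mod p^(w+2), against χ_p(x)^p = -1 for odd p.
    have hpow : ((p ^ (w + 1 + 1) : ℕ) : ℤ) ∣ x ^ (p : ℕ) - 1 := by
      rw [← mul_geom_sum, pow_succ]
      push_cast
      refine mul_dvd_mul ⟨t, by push_cast at ht; linear_combination ht⟩ ?_
      have h1 : ((p : ℕ) : ℤ) ∣ ∑ i ∈ Finset.range p, (x ^ i - 1) := by
        refine Finset.dvd_sum fun i _ ↦ ?_
        refine Dvd.dvd.trans ⟨p ^ w * t, ?_⟩ (sub_one_dvd_pow_sub_one x i)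
        push_cast at ht
        rw [ht]; ring
      rw [Finset.sum_sub_distrib] at h1
      simpa using (Int.dvd_add h1 (dvd_refl ((p : ℕ) : ℤ)))
    have h1 := primeComponent_eq_of_dvd_sub (χ := χ) p (hr ▸ hpow)
    rw [Int.cast_pow, map_pow, hχx, Int.cast_one, map_one,
      (hp.odd_of_ne_two hp2).neg_one_pow] at h1
    norm_num at h1

/-- Provides the residue class n₀ on which the sign condition kills coefficients; for ε = 1 this
needs χ_p to attain -1. -/
theorem exists_primeComponent_eq_neg [NeZero N] (hχ : χ.IsPrimitive) (hχ₂ : χ.IsQuadratic)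
    (p : N.primeFactors) (ε : ℤˣ) : ∃ n : ℤ, primeComponent χ p n = -((ε : ℤ) : ℂ) := by
  rcases Int.units_eq_one_or ε with rfl | rfl
  · obtain ⟨x, -, hx⟩ := exists_primeComponent_eq_neg_one hχ hχ₂ p
    exact ⟨x, by simpa using hx⟩
  · exact ⟨1, by simp⟩

end conductor

/-! ### Translates as multipliers on Fourier coefficients. -/

open Function.Periodic (qParam qParam_ne_zero)

theorem qParam_intCast_zpow_eq_one_iff {N : ℕ} [NeZero N] (x n : ℤ) :
    qParam (N : ℝ) (x : ℂ) ^ n = 1 ↔ (N : ℤ) ∣ x * n := by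
  have hN : (N : ℂ) ≠ 0 := by exact_mod_cast NeZero.ne N
  rw [qParam, ← Complex.exp_int_mul, Complex.exp_eq_one_iff]
  refine exists_congr fun t ↦ ?_
  have hpi : (2 * Real.pi * Complex.I : ℂ) ≠ 0 := Complex.two_pi_I_ne_zero
  have h1 : (n : ℂ) * (2 * Real.pi * Complex.I * x / (N : ℝ)) =
      (x * n / N : ℂ) * (2 * Real.pi * Complex.I) := by push_cast; ring
  rw [h1, mul_left_inj' hpi, div_eq_iff hN]
  constructor
  · intro h
    have : ((x * n : ℤ) : ℂ) = ((N * t : ℤ) : ℂ) := by push_cast; rw [h]; ring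
    exact_mod_cast this
  · intro h
    have : ((x * n : ℤ) : ℂ) = ((N * t : ℤ) : ℂ) := by rw [h]
    push_cast at this
    rw [this]; ring

theorem qParam_intCast_mul (h : ℝ) (x j : ℤ) :
    qParam h ((x * j : ℤ) : ℂ) = qParam h (x : ℂ) ^ j := by
  rw [qParam, qParam, ← Complex.exp_int_mul]
  congr 1
  push_cast
  ring

theorem HasFourierExpansion.eq_zero {h : ℕ} {g : ℍ → ℂ} {c : ℤ → ℂ}
    (hg : HasFourierExpansion h g c) (hc : ∀ n, c n = 0) : g = 0 := by
  funext τ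
  have := hg.2 τ
  simp only [hc, zero_mul] at this
  exact this.unique hasSum_zero

section multiplier

variable {N : ℕ} {k : ℤ} {g : ℍ → ℂ} {b : ℤ → ℂ} {E : ℤ} {q : ℕ}

/-- If no coefficient of `g` has index congruent to `n₀` modulo `q`, then the translates of `g`
satisfy a linear relation. -/
theorem sum_translates_eq_zero [NeZero N] (hb : HasFourierExpansion N g b)
    (hE : ∀ n : ℤ, (N : ℤ) ∣ E * n ↔ (q : ℤ) ∣ n) {n₀ : ℤ}
    (hn₀ : ∀ n : ℤ, (q : ℤ) ∣ n - n₀ → b n = 0) :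
    ∑ j ∈ Finset.range q, (qParam (N : ℝ) (E : ℂ) ^ (-n₀)) ^ j • g ∣[k] (T ^ (E * (j : ℤ))) = 0 := by
  have hω := qParam_ne_zero (h := (N : ℝ)) (E : ℂ)
  refine (HasFourierExpansion.sum (Finset.range q) fun j _ ↦ (hb.slash_T_zpow k
    (E * (j : ℤ))).const_smul ((qParam (N : ℝ) (E : ℂ) ^ (-n₀)) ^ j)).eq_zero fun n ↦ ?_
  rw [Finset.sum_apply]
  by_cases hn : (q : ℤ) ∣ n - n₀
  · simp [hn₀ n hn]
  -- The n-th coefficient is b(n) times a full geometric sum of a q-th root of unity, which differs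
  -- from 1 because n ≢ n₀ mod q.
  have hterm : ∀ j : ℕ, (qParam (N : ℝ) (E : ℂ) ^ (-n₀)) ^ j *
      (b n * qParam (N : ℝ) ((E * (j : ℤ) : ℤ) : ℂ) ^ n) =
      b n * (qParam (N : ℝ) (E : ℂ) ^ (n - n₀)) ^ j := by
    intro j
    rw [qParam_intCast_mul, sub_eq_add_neg, zpow_add₀ hω, mul_pow, ← zpow_natCast,
      ← zpow_natCast, ← zpow_mul, ← zpow_mul, ← zpow_mul, mul_comm (j : ℤ) n]
    ring
  simp only [hterm]
  rw [← Finset.mul_sum, geom_sum_eq, ← zpow_natCast, ← zpow_mul,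
    (qParam_intCast_zpow_eq_one_iff E _).mpr ((hE _).mpr (Dvd.intro_left _ rfl)), sub_self,
    zero_div, mul_zero]
  rwa [Ne, qParam_intCast_zpow_eq_one_iff, hE]

/-- The multiplier by which an element of the span of the translates acts on Fourier
coefficients. -/
noncomputable def translateMultiplier (N : ℕ) (E : ℤ) (s : Finset ℤ) (w : ℤ → ℂ) (n : ℤ) : ℂ :=
  ∑ j ∈ s, w j * qParam (N : ℝ) ((E * j : ℤ) : ℂ) ^ n

theorem HasFourierExpansion.sum_translates {G : ℍ → ℂ} {c : ℤ → ℂ}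
    (hG : HasFourierExpansion N G c) (s : Finset ℤ) (w : ℤ → ℂ) :
    HasFourierExpansion N (∑ j ∈ s, w j • G ∣[k] (T ^ (E * j)))
      (fun n ↦ c n * translateMultiplier N E s w n) := by
  refine (HasFourierExpansion.sum s fun j _ ↦
    (hG.slash_T_zpow k (E * j)).const_smul (w j)).congr_coeff fun n ↦ ?_
  rw [Finset.sum_apply, translateMultiplier, Finset.mul_sum]
  exact Finset.sum_congr rfl fun j _ ↦ by ring

theorem exists_sum_of_mem_translateSpan {x : ℍ → ℂ} (hx : x ∈ translateSpan k g E) :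
    ∃ (s : Finset ℤ) (w : ℤ → ℂ), x = ∑ j ∈ s, w j • g ∣[k] (T ^ (E * j)) := by
  obtain ⟨c, hc⟩ := Finsupp.mem_span_range_iff_exists_finsupp.mp hx
  exact ⟨c.support, c, hc.symm⟩

end multiplier

/-! ### The multiplier at one prime and its nonvanishing. -/

section multiplicative

variable {N : ℕ} {k : ℤ} {χ : DirichletCharacter ℂ N} {g : ℍ → ℂ} {b : ℤ → ℂ}

theorem dvd_primeIdempotent_mul_iff (p : N.primeFactors) (n : ℤ) :
    (N : ℤ) ∣ primeIdempotent N p * n ↔ ((p ^ N.factorization p : ℕ) : ℤ) ∣ n := by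
  rw [← primeIdempotent_mul_eq_zero_iff, ← ZMod.intCast_zmod_eq_zero_iff_dvd, Int.cast_mul]

theorem natCast_mul_primeIdempotent (p : N.primeFactors) :
    ((p ^ N.factorization p : ℕ) * primeIdempotent N p : ZMod N) = 0 := by
  have := (primeIdempotent_mul_eq_zero_iff p ((p ^ N.factorization p : ℕ) : ℤ)).mpr dvd_rfl
  rw [mul_comm]
  exact_mod_cast this

/-- The inversion of `g` at a single prime is a linear combination of translates of `g`. -/
theorem slash_partialInversion_mem [NeZero N] (hχ : χ.IsPrimitive) (hχ₂ : χ.IsQuadratic)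
    (hg : IsRowInvariant N k χ g) (hb : HasFourierExpansion N g b) (p : N.primeFactors) (ε : ℤˣ)
    (hε : ∀ n : ℤ, primeComponent χ p n = -((ε : ℤ) : ℂ) → b n = 0) (Q : ℤ) :
    g ∣[k] partialInversion (primeIdempotent N p) Q ∈
      translateSpan k g (primeIdempotent N p) := by
  have hp := Nat.prime_of_mem_primeFactors p.2
  obtain ⟨n₀, hn₀⟩ := exists_primeComponent_eq_neg hχ hχ₂ p ε
  have hE := primeIdempotent_mul_self p
  have hrel := sum_translates_eq_zero (k := k) hb (q := p ^ N.factorization p)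
    (dvd_primeIdempotent_mul_iff p) (n₀ := n₀)
    fun n hn ↦ hε n (by rw [primeComponent_eq_of_dvd_sub p hn, hn₀])
  have hr : (qParam (N : ℝ) (primeIdempotent N p : ℂ) ^ (-n₀)) ^ ((p : ℕ) ^ N.factorization p) =
      1 := by
    rw [← zpow_natCast, ← zpow_mul, qParam_intCast_zpow_eq_one_iff, dvd_primeIdempotent_mul_iff]
    exact Dvd.intro_left _ rfl
  have hq := natCast_mul_primeIdempotent p
  rw [hg.slash_partialInversion hE]
  rcases factorization_cases hχ hχ₂ p with ⟨-, h⟩ | ⟨h2, h, hx⟩ | ⟨h2, h, hx⟩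
  · rw [h, pow_one] at hrel hq
    exact hg.invertedTranslate_mem_of_prime hE hp hq hrel Q
  · rw [h, h2] at hrel hq hr
    rw [primeComponent_intCast] at hx
    refine hg.invertedTranslate_mem_of_four hE ?_ ?_ (r := _) hr hrel Q
    · norm_num at hq; exact hq
    · exact_mod_cast hx
  · rw [h, h2] at hrel hq hr
    rw [primeComponent_intCast] at hx
    refine hg.invertedTranslate_mem_of_eight hE ?_ ?_ hχ₂ (r := _) hr hrel Q
    · norm_num at hq; exact hq
    · exact_mod_cast hx

/-- The inversion at a single prime, with control of the zeros of the multiplier. -/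
theorem exists_slash_partialInversion_eq [NeZero N] (hχ : χ.IsPrimitive) (hχ₂ : χ.IsQuadratic)
    (hg : IsRowInvariant N k χ g) (hb : HasFourierExpansion N g b) (hg0 : g ≠ 0)
    (p : N.primeFactors) (ε : ℤˣ)
    (hε : ∀ n : ℤ, primeComponent χ p n = -((ε : ℤ) : ℂ) → b n = 0) (Q : ℤ) :
    ∃ (s : Finset ℤ) (w : ℤ → ℂ), g ∣[k] partialInversion (primeIdempotent N p) Q =
        ∑ j ∈ s, w j • g ∣[k] (T ^ (primeIdempotent N p * j)) ∧
      (¬ ((p : ℕ) : ℤ) ∣ Q ∨ ((p ^ N.factorization p : ℕ) : ℤ) ∣ Q → ∀ n, Q ∣ n →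
        translateMultiplier N (primeIdempotent N p) s w n ≠ 0) := by
  have hp := Nat.prime_of_mem_primeFactors p.2
  have hE := primeIdempotent_mul_self p
  by_cases hpQ : ((p : ℕ) : ℤ) ∣ Q
  · obtain ⟨s, w, h⟩ := exists_sum_of_mem_translateSpan
      (slash_partialInversion_mem hχ hχ₂ hg hb p ε hε Q)
    refine ⟨s, w, h, ?_⟩
    rintro (h' | hqQ) n hn
    · exact absurd hpQ h'
    have hexp := hb.sum_translates (k := k) (E := primeIdempotent N p) s w
    rw [← h] at hexp
    set κ := translateMultiplier N (primeIdempotent N p) s w with hκ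
    have hκ0 : ∀ n, ((p ^ N.factorization p : ℕ) : ℤ) ∣ n → κ n = κ 0 := by
      intro n hn
      rw [hκ, translateMultiplier, translateMultiplier]
      refine Finset.sum_congr rfl fun j _ ↦ ?_
      rw [zpow_zero, (qParam_intCast_zpow_eq_one_iff _ n).mpr]
      rw [mul_assoc, dvd_primeIdempotent_mul_iff]
      exact hn.mul_left j
    rw [hκ0 n (hqQ.trans hn)]
    intro hzero
    -- As p^v ∣ Q, the row at p is (0, -1), which T^e fixes; so the inverted form has coefficients
    -- only at multiples of p^v. There the multiplier is κ(0), so κ(0) = 0 would make the form, and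
    -- hence g, vanish.
    have hinv : (g ∣[k] partialInversion (primeIdempotent N p) Q) ∣[k]
        (T ^ (primeIdempotent N p * 1)) = g ∣[k] partialInversion (primeIdempotent N p) Q := by
      rw [hg.slash_partialInversion hE]
      have hQ := (primeIdempotent_mul_eq_zero_iff p Q).mpr hqQ
      simpa using hg.invertedTranslate_slash hE Q 1 Q 0 1 isUnit_one (by ring)
        (by push_cast; linear_combination hQ)
    have huniq := (hexp.slash_T_zpow k (primeIdempotent N p * 1)).unique
      (Nat.pos_of_ne_zero (NeZero.ne N)) (hinv.symm ▸ hexp)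
    have hall : ∀ n, b n * κ n = 0 := by
      intro n
      by_cases hn : ((p ^ N.factorization p : ℕ) : ℤ) ∣ n
      · rw [hκ0 n hn, hzero, mul_zero]
      · have h1 := congrFun huniq n
        have h2 : qParam (N : ℝ) ((primeIdempotent N p * 1 : ℤ) : ℂ) ^ n ≠ 1 := by
          rwa [Ne, qParam_intCast_zpow_eq_one_iff, mul_one, dvd_primeIdempotent_mul_iff]
        by_contra h3
        exact h2 ((mul_eq_left₀ h3).mp h1)
    have := hexp.eq_zero hall
    rw [SlashAction.slash_eq_zero_iff] at this
    exact hg0 this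
  · have hc : IsCoprime Q ((p ^ N.factorization p : ℕ) : ℤ) := by
      push_cast
      exact (((Nat.prime_iff_prime_int.mp hp).coprime_iff_not_dvd.mpr hpQ).symm).pow_right
    obtain ⟨j', hj'⟩ := IsRowInvariant.exists_mul_eq_of_isCoprime
      (natCast_mul_primeIdempotent p) hc
    refine ⟨{-j'}, fun _ ↦ χ (1 - primeIdempotent N p + primeIdempotent N p * Q), ?_, ?_⟩
    · rw [hg.slash_partialInversion hE, hg.invertedTranslate_of_unit hE hj',
        Finset.sum_singleton]
    · intro _ n _
      rw [translateMultiplier, Finset.sum_singleton]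
      exact mul_ne_zero ((IsRowInvariant.isUnit_one_sub_add hE hj').map χ).ne_zero
        (zpow_ne_zero _ (qParam_ne_zero _))

end multiplicative

/-! ### Assembling the primes: the expansion at 1/m. -/

/-- If the inversion at each prime acts on `g` as a combination of translates, then the inversion
at a set of primes acts on Fourier coefficients through the product of the multipliers. -/
theorem HasFourierExpansion.slash_partialInversion_sum {N : ℕ} {k : ℤ}
    {χ : DirichletCharacter ℂ N} {g : ℍ → ℂ} {b : ℤ → ℂ} (hg : IsRowInvariant N k χ g)
    (hb : HasFourierExpansion N g b) (Q : ℤ) (S : N.primeFactors → Finset ℤ)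
    (w : N.primeFactors → ℤ → ℂ)
    (hSw : ∀ p, g ∣[k] partialInversion (primeIdempotent N p) Q =
      ∑ j ∈ S p, w p j • g ∣[k] (T ^ (primeIdempotent N p * j)))
    (s : Finset N.primeFactors) :
    HasFourierExpansion N (g ∣[k] partialInversion (∑ p ∈ s, primeIdempotent N p) Q)
      (fun n ↦ b n * ∏ p ∈ s, translateMultiplier N (primeIdempotent N p) (S p) (w p) n) := by
  induction s using Finset.induction_on with
  | empty =>
    have h : g ∣[k] partialInversion (∑ p ∈ (∅ : Finset N.primeFactors), primeIdempotent N p) Q =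
        g := by
      rw [Finset.sum_empty]
      refine (hg.slash_eq (γ := 1) ?_ ?_).trans (SlashAction.slash_one k g)
      · rw [partialInversion_apply_zero_zero (by simp)]
        simp
      · rw [partialInversion_apply_zero_one (by simp)]
        simp
    rw [h]
    exact hb.congr_coeff fun n ↦ by simp
  | insert p s hp ih =>
    set e := primeIdempotent N p with he
    set f := ∑ p ∈ s, primeIdempotent N p with hf
    have hee : (e : ZMod N) * e = e := primeIdempotent_mul_self p
    have hff : (f : ZMod N) * f = f := by
      have := sum_primeIdempotent_mul_self s
      rw [hf]; push_cast; exact this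
    have hef : (e : ZMod N) * f = 0 := by
      have := primeIdempotent_mul_sum_of_notMem hp
      rw [hf]; push_cast; exact this
    have hsum : ((e + f : ℤ) : ZMod N) * (e + f : ℤ) = (e + f : ℤ) := by
      push_cast; linear_combination hee + hff + 2 * hef
    rw [Finset.sum_insert hp]
    -- Since ef = 0, inversions at disjoint parts compose to the inversion at their union, and
    -- translation by multiples of e commutes with inversion at f. Only the first rows mod N need to
    -- agree.
    have h1 : g ∣[k] partialInversion (e + f) Q =
        g ∣[k] (partialInversion e Q * partialInversion f Q) := by
      refine hg.slash_eq ?_ ?_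
      · rw [specialLinearGroup_mul_apply, partialInversion_apply_zero_zero hsum]
        push_cast
        rw [partialInversion_apply_zero_zero hee, partialInversion_apply_zero_one hee,
          partialInversion_apply_zero_zero hff, partialInversion_apply_one_zero]
        linear_combination (1 - (Q - 1) ^ 2 : ZMod N) * hef
      · rw [specialLinearGroup_mul_apply, partialInversion_apply_zero_one hsum]
        push_cast
        rw [partialInversion_apply_zero_zero hee, partialInversion_apply_zero_one hee,
          partialInversion_apply_zero_one hff, partialInversion_apply_one_one hff]
        linear_combination (Q - 2 : ZMod N) * hef
    have h2 : ∀ j : ℤ, g ∣[k] (T ^ (e * j) * partialInversion f Q) =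
        g ∣[k] (partialInversion f Q * T ^ (e * j)) := by
      intro j
      refine hg.slash_eq ?_ ?_
      · rw [specialLinearGroup_mul_apply, specialLinearGroup_mul_apply, T_zpow_apply_zero_zero,
          T_zpow_apply_zero_one, T_zpow_apply_one_zero]
        push_cast
        rw [partialInversion_apply_zero_zero hff, partialInversion_apply_one_zero]
        linear_combination (j : ZMod N) * hef
      · rw [specialLinearGroup_mul_apply, specialLinearGroup_mul_apply, T_zpow_apply_zero_zero,
          T_zpow_apply_zero_one, T_zpow_apply_one_one]
        push_cast
        rw [partialInversion_apply_zero_zero hff, partialInversion_apply_zero_one hff,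
          partialInversion_apply_one_one hff]
        linear_combination (-j * Q : ZMod N) * hef
    have h3 : g ∣[k] partialInversion (e + f) Q =
        ∑ j ∈ S p, w p j • (g ∣[k] partialInversion f Q) ∣[k] (T ^ (e * j)) := by
      rw [h1, SlashAction.slash_mul, hSw p, SlashAction.sum_slash]
      refine Finset.sum_congr rfl fun j _ ↦ ?_
      rw [ModularForm.SL_smul_slash, ← SlashAction.slash_mul, h2, SlashAction.slash_mul]
    rw [h3]
    refine (ih.sum_translates (S p) (w p)).congr_coeff fun n ↦ ?_
    rw [Finset.prod_insert hp]
    ring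

/-- The expansion of a form in `A^ε(N, k, χ)` at the cusp `1/m`, in powers of `e^(2πi τ m / N)`. -/
theorem exists_expansion_slash_lowerUnipotent {N m Q : ℕ} [NeZero N] [NeZero m] [NeZero Q]
    (hmQ : m * Q = N) {k : ℤ} {χ : DirichletCharacter ℂ N} (hχ : χ.IsPrimitive)
    (hχ₂ : χ.IsQuadratic) {ε : N.primeFactors → ℤˣ} {f : ℍ → ℂ}
    (hf : ∀ M ∈ CongruenceSubgroup.Gamma0 N, f ∣[k] M = χ ((M 1 1 : ℤ) : ZMod N) • f)
    {a : ℤ → ℂ} (ha : HasFourierExpansion 1 f a)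
    (haε : ∀ n : ℤ, (∃ p : N.primeFactors, primeComponent χ p n = -((ε p : ℤ) : ℂ)) → a n = 0) :
    ∃ c : ℤ → ℂ, HasFourierExpansion Q (f ∣[k] lowerUnipotent m) c ∧
      (∀ n, c n ≠ 0 → a (n * Q) ≠ 0) ∧
      ((∀ p : ℕ, p.Prime → p ∣ Q → p ^ N.factorization p ∣ Q) → ∀ n, a (n * Q) ≠ 0 → c n ≠ 0) := by
  have hN : 0 < N := Nat.pos_of_ne_zero (NeZero.ne N)
  have hg := isRowInvariant_slash_levelScaling hχ₂ hf
  obtain ⟨C, hC, hb⟩ := ha.slash_levelScaling (N := N) k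
  rw [slash_lowerUnipotent hmQ]
  set g := f ∣[k] levelScaling N
  -- Nonvanishing of the multipliers requires g ≠ 0.
  by_cases hg0 : g = 0
  · have ha0 : ∀ n, a n = 0 := by
      have := (hg0 ▸ hb).unique hN (HasFourierExpansion.zero N)
      exact fun n ↦ (mul_eq_zero.mp (congrFun this n)).resolve_left hC
    refine ⟨0, ?_, fun n h ↦ absurd rfl h, fun _ n h ↦ absurd (ha0 _) h⟩
    rw [hg0, SlashAction.zero_slash, SlashAction.zero_slash]
    exact HasFourierExpansion.zero Q
  choose S w hSw hne using fun p : N.primeFactors ↦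
    exists_slash_partialInversion_eq hχ hχ₂ hg hb hg0 p (ε p)
      (fun n hn ↦ by rw [haε n ⟨p, hn⟩, mul_zero]) Q
  have hG := hb.slash_partialInversion_sum hg Q S w hSw Finset.univ
  have hone : ((∑ p : N.primeFactors, primeIdempotent N p : ℤ) : ZMod N) = 1 := by
    push_cast
    exact sum_primeIdempotent hN.ne'
  have hgone : g ∣[k] partialInversion (∑ p : N.primeFactors, primeIdempotent N p) Q =
      g ∣[k] partialInversion 1 Q := by
    refine hg.slash_eq ?_ ?_
    · rw [partialInversion_apply_zero_zero (by rw [hone, one_mul]),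
        partialInversion_apply_zero_zero (by simp), hone, Int.cast_one]
    · rw [partialInversion_apply_zero_one (by rw [hone, one_mul]),
        partialInversion_apply_zero_one (by simp), hone, Int.cast_one]
  rw [hgone] at hG
  -- T^m changes the row (Q, -1) to (Q, Qm - 1), the same mod N. So only exponents divisible by Q
  -- survive.
  have hinv : (g ∣[k] partialInversion 1 Q) ∣[k] (T ^ (m : ℤ)) = g ∣[k] partialInversion 1 Q := by
    rw [← SlashAction.slash_mul]
    have hQm : (Q * m : ZMod N) = 0 := by
      rw [← Nat.cast_mul, mul_comm, hmQ, ZMod.natCast_self]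
    refine hg.slash_eq ?_ ?_
    · rw [specialLinearGroup_mul_apply, T_zpow_apply_zero_zero, T_zpow_apply_one_zero]
      push_cast; ring
    · rw [specialLinearGroup_mul_apply, T_zpow_apply_zero_one, T_zpow_apply_one_one]
      push_cast
      rw [partialInversion_apply_zero_zero (by simp)]
      push_cast
      linear_combination hQm
  set c : ℤ → ℂ := fun n ↦ C * a n *
    ∏ p : N.primeFactors, translateMultiplier N (primeIdempotent N p) (S p) (w p) n with hc
  have hsupp : ∀ n, ¬ (Q : ℤ) ∣ n → c n = 0 := by
    intro n hn
    have huniq := congrFun ((hG.slash_T_zpow k m).unique hN (hinv.symm ▸ hG)) n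
    by_contra h
    have h1 := (mul_eq_left₀ h).mp huniq
    rw [qParam_intCast_zpow_eq_one_iff, ← hmQ, Nat.cast_mul] at h1
    exact hn (Int.dvd_of_mul_dvd_mul_left (by exact_mod_cast NeZero.ne m) h1)
  obtain ⟨ρ, hρ, hexp⟩ := hG.slash_cuspTriangular hmQ k hsupp
  refine ⟨_, hexp, fun n hn han ↦ hn ?_, fun hQ n hn ↦ mul_ne_zero (hρ n) ?_⟩
  · simp [hc, han]
  · refine mul_ne_zero (mul_ne_zero hC hn) (Finset.prod_ne_zero_iff.mpr fun p _ ↦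
      hne p ?_ _ (Dvd.intro_left _ rfl))
    by_cases hp : (p : ℕ) ∣ Q
    · exact Or.inr (Int.natCast_dvd_natCast.mpr
        (hQ p (Nat.prime_of_mem_primeFactors p.2) hp))
    · exact Or.inl fun h ↦ hp (Int.natCast_dvd_natCast.mp h)

/-! ### Cusp equivalence and widths. -/

section cusps

variable {N : ℕ} {γ : SL(2, ℤ)} {m : ℕ}

/-- A matrix that maps `∞` to a cusp equivalent to `1/m` lies in
`Γ₀(N) (1 0; m 1) ⟨T⟩`. -/
theorem CuspEquiv.exists_mul_eq (hm : 0 < m)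
    (h : CuspEquiv N (cuspOf γ) ((1 / (m : ℚ) : ℚ) : OnePoint ℚ)) :
    ∃ M ∈ CongruenceSubgroup.Gamma0 N, ∃ x : ℤ, M * γ = lowerUnipotent m * T ^ x := by
  obtain ⟨M, hM, h⟩ := h
  rw [cuspOf, ← mul_smul, ← map_mul, OnePoint.smul_infty_eq_ite] at h
  have hentry : ∀ i j, (mapGL ℚ (M * γ) : Matrix (Fin 2) (Fin 2) ℚ) i j = ((M * γ) i j : ℤ) :=
    fun i j ↦ rfl
  rw [hentry, hentry] at h
  split_ifs at h with hc
  · exact absurd h (OnePoint.infty_ne_coe _)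
  have hmQ : (m : ℚ) ≠ 0 := by exact_mod_cast hm.ne'
  have h1 : (M * γ) 0 0 * m = (M * γ) 1 0 := by
    have := OnePoint.coe_injective h
    rw [div_eq_div_iff hc hmQ, one_mul] at this
    exact_mod_cast this
  have hdet : (M * γ) 0 0 * (M * γ) 1 1 - (M * γ) 0 1 * (M * γ) 1 0 = 1 := by
    have := (M * γ).2
    rwa [Matrix.det_fin_two] at this
  have key : ∀ M' ∈ CongruenceSubgroup.Gamma0 N, (M' * γ) 0 0 = 1 → (M' * γ) 1 0 = m →
      ∃ M ∈ CongruenceSubgroup.Gamma0 N, ∃ x : ℤ, M * γ = lowerUnipotent m * T ^ x := by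
    intro M' hM' h00 h10
    refine ⟨M', hM', (M' * γ) 0 1, ?_⟩
    have hdet : (M' * γ) 0 0 * (M' * γ) 1 1 - (M' * γ) 0 1 * (M' * γ) 1 0 = 1 := by
      have := (M' * γ).2
      rwa [Matrix.det_fin_two] at this
    have h11 : (M' * γ) 1 1 = 1 + (M' * γ) 0 1 * m := by
      rw [h00, h10] at hdet; linear_combination hdet
    apply Subtype.ext
    rw [coe_mul (lowerUnipotent _), coe_lowerUnipotent, ModularGroup.coe_T_zpow,
      Matrix.mul_fin_two, Matrix.eta_fin_two (M' * γ : SL(2, ℤ)).1]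
    rw [h00, h10, h11]
    simp [mul_comm, add_comm]
  -- The first column is c(1, m) with c a unit of ℤ; the sign is absorbed by -1 ∈ Γ₀(N).
  have hunit : (M * γ) 0 0 * ((M * γ) 1 1 - (M * γ) 0 1 * m) = 1 := by
    rw [← h1] at hdet; linear_combination hdet
  rcases Int.isUnit_iff.mp (IsUnit.of_mul_eq_one _ hunit) with h2 | h2
  · exact key M hM h2 (by rw [← h1, h2, one_mul])
  · have hneg : ∀ i j, (-M * γ) i j = -((M * γ) i j) := fun i j ↦ by
      rw [neg_mul]; rfl
    refine key (-M) ?_ (by rw [hneg, h2]; rfl) (by rw [hneg, ← h1, h2]; ring)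
    rw [CongruenceSubgroup.Gamma0_mem] at hM ⊢
    have : (-M) 1 0 = -(M 1 0) := rfl
    rw [this, Int.cast_neg, hM, neg_zero]

theorem cuspWidth_eq (hm : 0 < m) (h : CuspEquiv N (cuspOf γ) ((1 / (m : ℚ) : ℚ) : OnePoint ℚ))
    {w : ℕ} (hw : 0 < w) (hwm : ∀ t : ℕ, N ∣ m ^ 2 * t ↔ w ∣ t) : cuspWidth N γ = w := by
  obtain ⟨M, hM, x, hMγ⟩ := h.exists_mul_eq hm
  have hmem : ∀ t : ℕ, γ * T ^ t * γ⁻¹ ∈ CongruenceSubgroup.Gamma0 N ↔ w ∣ t := by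
    intro t
    have h1 : γ * T ^ t * γ⁻¹ =
        M⁻¹ * (lowerUnipotent m * T ^ (t : ℤ) * (lowerUnipotent m)⁻¹) * M := by
      have hγ : γ = M⁻¹ * (lowerUnipotent m * T ^ x) := by rw [← hMγ, inv_mul_cancel_left]
      rw [hγ, zpow_natCast]
      have hcomm : T ^ x * T ^ t * (T ^ x)⁻¹ = T ^ t := by
        rw [← zpow_natCast, ← zpow_neg, ← zpow_add, ← zpow_add]
        congr 1; ring
      calc _ = M⁻¹ * (lowerUnipotent m * (T ^ x * T ^ t * (T ^ x)⁻¹) * (lowerUnipotent m)⁻¹) * M := by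
            group
        _ = _ := by rw [hcomm]
    -- The factors M and T^x drop out, so membership in Γ₀(N) reduces to N ∣ m²t.
    have h2 : (lowerUnipotent m * T ^ (t : ℤ) * (lowerUnipotent m)⁻¹) 1 0 = -(m ^ 2 * t : ℤ) := by
      simp only [specialLinearGroup_mul_apply, T_zpow_apply_zero_zero, T_zpow_apply_zero_one,
        T_zpow_apply_one_zero, T_zpow_apply_one_one]
      simp [SL2_inv_expl, coe_lowerUnipotent]
      ring
    rw [h1, Subgroup.mul_mem_cancel_right _ hM,
      Subgroup.mul_mem_cancel_left _ (Subgroup.inv_mem _ hM), CongruenceSubgroup.Gamma0_mem, h2,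
      ZMod.intCast_zmod_eq_zero_iff_dvd, dvd_neg, ← hwm]
    exact_mod_cast Iff.rfl
  rw [cuspWidth]
  simp only [hmem]
  refine le_antisymm (Nat.sInf_le ⟨hw, dvd_rfl⟩) (le_csInf ⟨w, hw, dvd_rfl⟩ ?_)
  rintro t ⟨ht, hwt⟩
  exact Nat.le_of_dvd ht hwt

/-- The expansion of a form in `A^ε(N, k, χ)` at a cusp equivalent to `1/m`. -/
theorem exists_expansion_at_cusp {Q : ℕ} [NeZero N]
    (hmQ : m * Q = N) {k : ℤ} {χ : DirichletCharacter ℂ N} (hχ : χ.IsPrimitive)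
    (hχ₂ : χ.IsQuadratic) {ε : N.primeFactors → ℤˣ} {f : ℍ → ℂ}
    (hf : f ∈ weaklyHolomorphicEps N k χ ε) {a : ℤ → ℂ} (ha : HasFourierExpansion 1 f a)
    (h : CuspEquiv N (cuspOf γ) ((1 / (m : ℚ) : ℚ) : OnePoint ℚ)) :
    ∃ c : ℤ → ℂ, HasFourierExpansion Q (f ∣[k] γ) c ∧ (∀ n, c n ≠ 0 → a (n * Q) ≠ 0) ∧
      ((∀ p : ℕ, p.Prime → p ∣ Q → p ^ N.factorization p ∣ Q) → ∀ n, a (n * Q) ≠ 0 → c n ≠ 0) := by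
  obtain ⟨hf, a', ha', haε⟩ := hf
  obtain rfl : a = a' := ha.unique one_pos ha'
  have hN : m * Q ≠ 0 := hmQ ▸ NeZero.ne N
  have : NeZero m := ⟨left_ne_zero_of_mul hN⟩
  have : NeZero Q := ⟨right_ne_zero_of_mul hN⟩
  obtain ⟨M, hM, x, hMγ⟩ := h.exists_mul_eq (Nat.pos_of_ne_zero (NeZero.ne m))
  obtain ⟨c, hc, hca, hac⟩ := exists_expansion_slash_lowerUnipotent hmQ hχ hχ₂ hf.slash ha haε
  have hu : IsUnit ((M 1 1 : ℤ) : ZMod N) := by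
    rw [CongruenceSubgroup.Gamma0_mem] at hM
    have hdet := M.2
    rw [Matrix.det_fin_two] at hdet
    have := congrArg (Int.cast (R := ZMod N)) hdet
    push_cast at this
    rw [hM] at this
    exact IsUnit.of_mul_eq_one ((M 0 0 : ℤ) : ZMod N) (by linear_combination this)
  have hχM : χ ((M 1 1 : ℤ) : ZMod N) ≠ 0 := (hu.map χ).ne_zero
  have hfγ : f ∣[k] γ = (χ ((M 1 1 : ℤ) : ZMod N))⁻¹ • (f ∣[k] lowerUnipotent m) ∣[k] (T ^ x) := by
    rw [← SlashAction.slash_mul, ← hMγ, SlashAction.slash_mul, hf.slash M hM,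
      ModularForm.SL_smul_slash, inv_smul_smul₀ hχM]
  rw [hfγ]
  have hq : ∀ n : ℤ, qParam (Q : ℝ) (x : ℂ) ^ n ≠ 0 := fun n ↦ zpow_ne_zero _ (qParam_ne_zero _)
  refine ⟨_, (hc.slash_T_zpow k x).const_smul _, fun n hn ↦ hca n ?_, fun hQ n hn ↦ ?_⟩
  · exact left_ne_zero_of_mul (right_ne_zero_of_mul hn)
  · exact mul_ne_zero (inv_ne_zero hχM) (mul_ne_zero (hac hQ n hn) (hq n))

end cusps

/-! ### Divisors of the conductor and the three kinds of cusps. -/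

section widths

variable {N : ℕ} [NeZero N] {χ : DirichletCharacter ℂ N} {m₁ : ℕ}

theorem factorization_eq_one_of_odd (hχ : χ.IsPrimitive) (hχ₂ : χ.IsQuadratic) {p : ℕ}
    (hp : p.Prime) (hp2 : p ≠ 2) (hpN : p ∣ N) : N.factorization p = 1 := by
  rcases factorization_cases hχ hχ₂ ⟨p, hp.mem_primeFactors hpN (NeZero.ne N)⟩ with
    ⟨-, h⟩ | ⟨h, -⟩ | ⟨h, -⟩
  · exact h
  · exact absurd h hp2
  · exact absurd h hp2

theorem factorization_two_le (hχ : χ.IsPrimitive) (hχ₂ : χ.IsQuadratic) :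
    N.factorization 2 ≤ 3 := by
  by_cases h2 : 2 ∣ N
  · rcases factorization_cases hχ hχ₂ ⟨2, Nat.prime_two.mem_primeFactors h2 (NeZero.ne N)⟩ with
      ⟨h, -⟩ | ⟨-, h, -⟩ | ⟨-, h, -⟩
    · exact absurd rfl h
    · exact h.trans_le (by norm_num)
    · exact h.le
  · rw [Nat.factorization_eq_zero_of_not_dvd h2]
    exact Nat.zero_le _

/-- A divisor of `N` that is divisible by the full `p`-part of `N` for each of its primes `p` is
coprime to its codivisor. -/
theorem coprime_of_ordProj_dvd {m Q : ℕ} (hmQ : m * Q = N)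
    (h : ∀ p : ℕ, p.Prime → p ∣ m → p ^ N.factorization p ∣ m) : m.Coprime Q := by
  refine Nat.coprime_of_dvd fun p hp hpm hpQ ↦
    Nat.pow_succ_factorization_not_dvd (NeZero.ne N) hp ?_
  rw [pow_succ]
  conv_rhs => rw [← hmQ]
  exact mul_dvd_mul (h p hp hpm) hpQ

/-- Odd primes divide N exactly once, so an odd divisor contains the full p-part at each of its
primes. -/
theorem coprime_of_odd (hχ : χ.IsPrimitive) (hχ₂ : χ.IsQuadratic) {Q : ℕ} (hmQ : m₁ * Q = N)
    (hm₁ : Odd m₁) : m₁.Coprime Q := by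
  refine coprime_of_ordProj_dvd hmQ fun p hp hpm ↦ ?_
  rw [factorization_eq_one_of_odd hχ hχ₂ hp ?_ (hmQ ▸ hpm.mul_right Q), pow_one]
  · exact hpm
  · rintro rfl
    exact (Nat.not_even_iff_odd.mpr hm₁) (even_iff_two_dvd.mpr hpm)

end widths

theorem proposition3p4 (N : ℕ) (hN : 0 < N) (k : ℤ)
    (χ : DirichletCharacter ℂ N) (hχ : χ.IsPrimitive) (hχ₂ : χ.IsQuadratic)
    (ε : N.primeFactors → ℤˣ)
    (f : ℍ → ℂ) (hf : f ∈ weaklyHolomorphicEps N k χ ε)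
    (a : ℤ → ℂ) (ha : HasFourierExpansion 1 f a)
    (γ : SL(2, ℤ)) (m₁ : ℕ) (hm₁ : m₁ ∣ N) (hm₁_odd : Odd m₁) :
    (∀ m : ℕ, (m = m₁ ∨ m = 2 ^ N.factorization 2 * m₁) →
      CuspEquiv N (cuspOf γ) ((1 / (m : ℚ) : ℚ) : OnePoint ℚ) →
      ∃ c : ℤ → ℂ, HasFourierExpansion (cuspWidth N γ) (f ∣[k] γ) c ∧
        ∀ n : ℤ, c n ≠ 0 ↔ a (n * ((N / m : ℕ) : ℤ)) ≠ 0) ∧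
    (4 ∣ N → CuspEquiv N (cuspOf γ) ((1 / ((2 * m₁ : ℕ) : ℚ) : ℚ) : OnePoint ℚ) →
      ∃ c : ℤ → ℂ, HasFourierExpansion (2 * cuspWidth N γ) (f ∣[k] γ) c ∧
        ∀ n : ℤ, c n ≠ 0 → a (n * ((N / (2 * m₁) : ℕ) : ℤ)) ≠ 0) ∧
    (8 ∣ N → CuspEquiv N (cuspOf γ) ((1 / ((4 * m₁ : ℕ) : ℚ) : ℚ) : OnePoint ℚ) →
      ∃ c : ℤ → ℂ, HasFourierExpansion (2 * cuspWidth N γ) (f ∣[k] γ) c ∧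
        ∀ n : ℤ, c n ≠ 0 → a (n * ((N / (4 * m₁) : ℕ) : ℤ)) ≠ 0) := by
  have : NeZero N := ⟨hN.ne'⟩
  have hm₁0 : 0 < m₁ := hm₁_odd.pos
  have hcop2 : Nat.Coprime 2 m₁ := Nat.coprime_two_left.mpr hm₁_odd
  have hpow : ∀ v, 2 ^ v ∣ N → 2 ^ v * m₁ ∣ N := fun v hv ↦
    (hcop2.pow_left v).mul_dvd_of_dvd_of_dvd hv hm₁
  refine ⟨fun m hm hs ↦ ?_, fun h4 hs ↦ ?_, fun h8 hs ↦ ?_⟩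
  · have hmN : m ∣ N := by
      rcases hm with rfl | rfl
      · exact hm₁
      · exact hpow _ (Nat.ordProj_dvd N 2)
    have hmQ : m * (N / m) = N := Nat.mul_div_cancel' hmN
    have hm0 : 0 < m := Nat.pos_of_dvd_of_pos hmN hN
    have hQ0 : 0 < N / m := Nat.div_pos (Nat.le_of_dvd hN hmN) hm0
    set Q := N / m
    -- Coprimality of m and Q makes the width Q. It also puts the full p-part of N into Q for every
    -- p ∣ Q, as the converse implication requires.
    have hcop : m.Coprime Q := by
      rcases hm with rfl | rfl
      · exact coprime_of_odd hχ hχ₂ hmQ hm₁_odd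
      · refine coprime_of_ordProj_dvd hmQ fun p hp hpm ↦ ?_
        by_cases hp2 : p = 2
        · rw [hp2]; exact Dvd.intro _ rfl
        · rwa [factorization_eq_one_of_odd hχ hχ₂ hp hp2 (hpm.trans hmN), pow_one]
    have hwidth : cuspWidth N γ = Q := by
      refine cuspWidth_eq hm0 hs hQ0 fun t ↦ ?_
      rw [← hmQ, sq, mul_assoc, Nat.mul_dvd_mul_iff_left hm0]
      exact hcop.symm.dvd_mul_left
    obtain ⟨c, hc, hca, hac⟩ := exists_expansion_at_cusp hmQ hχ hχ₂ hf ha hs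
    refine ⟨c, hwidth ▸ hc, fun n ↦ ⟨hca n, hac (fun p hp hpQ ↦ ?_) n⟩⟩
    have hpm : Nat.Coprime (p ^ N.factorization p) m := by
      refine Nat.Coprime.pow_left _ ((Nat.Prime.coprime_iff_not_dvd hp).mpr fun hpm ↦ ?_)
      exact hp.one_lt.ne' (Nat.dvd_one.mp (hcop ▸ Nat.dvd_gcd hpm hpQ))
    exact hpm.dvd_of_dvd_mul_left (hmQ.symm ▸ Nat.ordProj_dvd N p)
  · obtain ⟨w, hw⟩ := hpow 2 (by norm_num; exact h4)
    have hw0 : 0 < w := Nat.pos_of_ne_zero (by rintro rfl; omega)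
    -- Here Q = 2w but the width is w, so the parameter e^(2πiτ/Q) is the square root of q_s.
    have hmQ : 2 * m₁ * (2 * w) = N := by rw [hw]; ring
    have hcop : m₁.Coprime w := (coprime_of_odd hχ hχ₂ (Q := 4 * w) (by rw [hw]; ring)
      hm₁_odd).coprime_mul_left_right
    have hwidth : cuspWidth N γ = w := by
      refine cuspWidth_eq (by positivity) hs hw0 fun t ↦ ?_
      rw [hw, show (2 * m₁) ^ 2 * t = 2 ^ 2 * m₁ * (m₁ * t) by ring,
        Nat.mul_dvd_mul_iff_left (by positivity)]
      exact hcop.symm.dvd_mul_left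
    obtain ⟨c, hc, hca, -⟩ := exists_expansion_at_cusp hmQ hχ hχ₂ hf ha hs
    have hdiv : N / (2 * m₁) = 2 * w := Nat.div_eq_of_eq_mul_right (by positivity) hmQ.symm
    exact ⟨c, hwidth ▸ hc, hdiv ▸ hca⟩
  · obtain ⟨w, hw⟩ := hpow 3 (by norm_num; exact h8)
    have hw0 : 0 < w := Nat.pos_of_ne_zero (by rintro rfl; omega)
    have hmQ : 4 * m₁ * (2 * w) = N := by rw [hw]; ring
    have hcop : m₁.Coprime w := (coprime_of_odd hχ hχ₂ (Q := 8 * w) (by rw [hw]; ring)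
      hm₁_odd).coprime_mul_left_right
    -- N = 8m₁w has 2-part at most 8, so w is odd. This is needed because N ∣ (4m₁)²t reduces to w ∣
    -- 2m₁t.
    have hcop' : Nat.Coprime 2 w := by
      refine (Nat.Prime.coprime_iff_not_dvd Nat.prime_two).mpr fun ⟨u, hu⟩ ↦ ?_
      have h16 : 2 ^ 4 ∣ N := ⟨m₁ * u, by rw [hw, hu]; ring⟩
      have := (Nat.prime_two.pow_dvd_iff_le_factorization hN.ne').mp h16
      have := factorization_two_le hχ hχ₂
      omega
    have hwidth : cuspWidth N γ = w := by
      refine cuspWidth_eq (by positivity) hs hw0 fun t ↦ ?_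
      rw [hw, show (4 * m₁) ^ 2 * t = 2 ^ 3 * m₁ * (2 * m₁ * t) by ring,
        Nat.mul_dvd_mul_iff_left (by positivity)]
      exact (hcop'.mul_left hcop).symm.dvd_mul_left
    obtain ⟨c, hc, hca, -⟩ := exists_expansion_at_cusp hmQ hχ hχ₂ hf ha hs
    have hdiv : N / (4 * m₁) = 2 * w := Nat.div_eq_of_eq_mul_right (by positivity) hmQ.symm
    exact ⟨c, hwidth ▸ hc, hdiv ▸ hca⟩
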